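/- Let $n\ge 1$ and let $\log$ be the logarithm to a fixed base $b>1$. Consider the channel $\mathbf y=\mathbf H\mathbf x+\mathbf z$ with deterministic non-singular $\mathbf H\in\mathbb C^{n\times n}$, where the input $\mathbf x$ and the noise $\mathbf z$ are independent random vectors in $\mathbb C^n$. Let $\mathbf z$ be zero-mean and Gaussian (that is, its real and imaginary parts are jointly Gaussian; it may be proper or improper), with non-singular covariance matrix $\mathbf C_{\mathbf z}=\mathbb E[\mathbf z\mathbf z^H]$ and complementary covariance matrix $\mathbf P_{\mathbf z}=\mathbb E[\mathbf z\mathbf z^T]$. Let $\mathbf B_{\mathbf z}$ be any matrix with $\mathbf C_{\mathbf z}=\mathbf B_{\mathbf z}\mathbf B_{\mathbf z}^H$, let $\|\cdot\|_2$ be the Euclidean operator norm, and let $\lambda_1,\dots,\lambda_n$ be the singular values of $\mathbf B_{\mathbf z}^{-1}\mathbf P_{\mathbf z}\mathbf B_{\mathbf z}^{-T}$. Assume $$\left\|\mathbf B_{\mathbf z}^{-1}\mathbf P_{\mathbf z}\mathbf B_{\mathbf z}^{-T}\right\|_2<1,\qquad S\ \ge\ 2n\left\|\mathbf H^{-1}\mathbf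 C_{\mathbf z}\mathbf H^{-H}\right\|_2 .$$ Let $\mathcal I$ be the set of all input distributions on $\mathbb C^n\cong\mathbb R^{2n}$ that have a density with respect to Lebesgue measure and satisfy the average power constraint $\mathbb E[\mathbf x^H\mathbf x]\le S$, and define the capacity as $C=\sup_{\mathbf x\in\mathcal I} I(\mathbf x;\mathbf y)$, where $I$ denotes mutual information (the relative entropy, to base $b$, of the joint distribution with respect to the product of the marginals). Then $$C=2\log|\det\mathbf H|+n\log\!\left(S+\operatorname{tr}\!\left(\mathbf H^{-1}\mathbf C_{\mathbf z}\mathbf H^{-H}\right)\right)-\log\det\mathbf C_{\mathbf z}-\frac12\sum_{i=1}^n\log(1-\lambda_i^2)-n\log n .$$ Furthermore, there exists a zero-mean Gaussian random vector $\mathbf x\in\mathbb C^n$ with covariance matrix and complementary covariance matrix $$\mathbf C_{\mathbf x}=\frac1n\left(S+\operatorname{tr}\!\left(\mathbf H^{-1}\mathbf C_{\mathbf z}\mathbf H^{-H}\right)\right)\mathbf I_n-\mathbf H^{-1}\mathbf C_{\mathbf z}\mathbf H^{-H},\qquad \mathbf P_{\mathbf x}=-\mathbf H^{-1}\mathbf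 P_{\mathbf z}\mathbf H^{-T},$$ and any such $\mathbf x$ (independent of $\mathbf z$) is capacity-achieving: its distribution lies in $\mathcal I$ and $I(\mathbf x;\mathbf y)=C$. -/

import Mathlib

open MeasureTheory ProbabilityTheory
open scoped Matrix ENNReal

namespace ComplexChannel

/-- The Euclidean operator norm `‖A‖₂` of a square complex matrix. -/
noncomputable def opNorm₂ {n : ℕ} (A : Matrix (Fin n) (Fin n) ℂ) : ℝ :=
  ‖Matrix.toEuclideanCLM (n := Fin n) (𝕜 := ℂ) A‖

/-- The `i`-th singular value (`i = 0, …, n - 1`, with multiplicity, in descending order) of a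
square complex matrix. -/
noncomputable def singularValue {n : ℕ} (A : Matrix (Fin n) (Fin n) ℂ) (i : Fin n) : ℝ :=
  (Matrix.toEuclideanLin A).singularValues i

/-- Mean vector `E[x]` of a complex random vector `x` with law `μ`. -/
noncomputable def meanVec {n : ℕ} (μ : Measure (Fin n → ℂ)) : Fin n → ℂ :=
  fun i => ∫ x, x i ∂μ

/-- Covariance matrix `E[(x - m)(x - m)ᴴ]` of a complex random vector `x` with law `μ`. -/
noncomputable def covMatrix {n : ℕ} (μ : Measure (Fin n → ℂ)) : Matrix (Fin n) (Fin n) ℂ :=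
  Matrix.of fun i j => ∫ x, (x i - meanVec μ i) * starRingEnd ℂ (x j - meanVec μ j) ∂μ

/-- Complementary covariance matrix (pseudo-covariance matrix) `E[(x - m)(x - m)ᵀ]` of a complex
random vector `x` with law `μ`. -/
noncomputable def compCovMatrix {n : ℕ} (μ : Measure (Fin n → ℂ)) : Matrix (Fin n) (Fin n) ℂ :=
  Matrix.of fun i j => ∫ x, (x i - meanVec μ i) * (x j - meanVec μ j) ∂μ

/-- `μ` is the law of a zero-mean Gaussian complex random vector with covariance matrix `C` and
complementary covariance matrix `P`. Here `IsGaussian` refers to `ℂⁿ` as a real topological vector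
space, i.e. the vector of all real and imaginary parts is multivariate Gaussian. -/
structure IsZeroMeanGaussian {n : ℕ} (μ : Measure (Fin n → ℂ))
    (C P : Matrix (Fin n) (Fin n) ℂ) : Prop where
  gaussian : IsGaussian μ
  mean_eq : meanVec μ = 0
  cov_eq : covMatrix μ = C
  compCov_eq : compCovMatrix μ = P

/-- The joint law of `(x, y)` for `y = H x + z`, where `x` has law `μ`, `z` has law `ν`, and `x`
and `z` are independent. -/
noncomputable def jointLaw {m n : ℕ} (H : Matrix (Fin n) (Fin m) ℂ) (ν : Measure (Fin n → ℂ))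
    (μ : Measure (Fin m → ℂ)) : Measure ((Fin m → ℂ) × (Fin n → ℂ)) :=
  (μ.prod ν).map fun p => (p.1, H *ᵥ p.1 + p.2)

/-- Mutual information, to the logarithmic base `b`, of a pair of random variables with joint law
`ρ`: the relative entropy of the joint law with respect to the product of its marginals
(`klDiv` is in nats; division by `log b` changes the base). -/
noncomputable def mutualInfo {α β : Type*} [MeasurableSpace α] [MeasurableSpace β] (b : ℝ)
    (ρ : Measure (α × β)) : ℝ≥0∞ :=
  InformationTheory.klDiv ρ (ρ.fst.prod ρ.snd) / ENNReal.ofReal (Real.log b)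

/-- The admissible input laws under the average power constraint `E[xᴴ x] ≤ S`: probability laws on
`ℂⁿ` that have a density with respect to Lebesgue measure (of `ℝ²ⁿ`, identified with `ℂⁿ`). -/
def admissible (n : ℕ) (S : ℝ) : Set (Measure (Fin n → ℂ)) :=
  {μ | IsProbabilityMeasure μ ∧ μ ≪ volume ∧
    ∫⁻ x, ∑ i, ‖x i‖ₑ ^ 2 ∂μ ≤ ENNReal.ofReal S}

/-- Capacity of `y = H x + z`, with noise law `ν`, over a set `I` of admissible input laws. -/
noncomputable def capacity {m n : ℕ} (b : ℝ) (H : Matrix (Fin n) (Fin m) ℂ)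
    (ν : Measure (Fin n → ℂ)) (I : Set (Measure (Fin m → ℂ))) : ℝ≥0∞ :=
  ⨆ μ ∈ I, mutualInfo b (jointLaw H ν μ)

/-- The input law `μ` is capacity-achieving: admissible, with mutual information equal to the
capacity. -/
def IsCapacityAchieving {m n : ℕ} (b : ℝ) (H : Matrix (Fin n) (Fin m) ℂ)
    (ν : Measure (Fin n → ℂ)) (I : Set (Measure (Fin m → ℂ))) (μ : Measure (Fin m → ℂ)) : Prop :=
  μ ∈ I ∧ mutualInfo b (jointLaw H ν μ) = capacity b H ν I

end ComplexChannel

open ComplexChannel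

/-! ### Relative entropy and mutual information: chain rule and invariance -/

namespace InformationTheory

variable {α β : Type*} [MeasurableSpace α] [MeasurableSpace β]

/-! The channel becomes 2n parallel real Gaussian channels. With B = H⁻¹B_z and M = B_z⁻¹P_zB_z⁻ᵀ,
the noise H⁻¹z has covariance BBᴴ and complementary covariance BMBᵀ. Diagonalizing the real
covariance of its real and imaginary parts gives an isometry T : ℝ²ⁿ → ℂⁿ under which the noise has
independent entries of variances dᵢ (`exists_real_diagonalization`). Mutual information is unchanged
by these coordinates.

Upper bound: replacing the output law in I(x;y) by any law q can only increase the divergence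
(`klDiv_prod_snd_le`). For q = N(0,s)²ⁿ with 2ns = S + ∑dᵢ, the divergence is ½∑log(s/dᵢ) + (E|x|² −
S)/(2s), and the power constraint makes the last term nonpositive.

Attainment: independent inputs of variances s − dᵢ make the output exactly q with full power. This
needs dᵢ < s, which follows from the two norm hypotheses (`realCov_quadForm_pos_lt`); back in ℂⁿ
these inputs have the stated covariances, which determine a zero-mean Gaussian law.

The closed formula comes from ∏dᵢ, computed by comparing the real covariance with the augmented
matrix [C P; P̄ C̄] (`det_realCov`). -/

lemma klDiv_map_measurableEquiv (e : α ≃ᵐ β) (μ ν : Measure α) [IsFiniteMeasure μ]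
    [IsFiniteMeasure ν] : klDiv (μ.map e) (ν.map e) = klDiv μ ν := by
  refine le_antisymm (klDiv_map_le μ ν e.measurable) ?_
  have h := klDiv_map_le (μ.map e) (ν.map e) e.symm.measurable
  rwa [Measure.map_map e.symm.measurable e.measurable, Measure.map_map e.symm.measurable
    e.measurable, e.symm_comp_self, Measure.map_id, Measure.map_id] at h

/-- By the chain rule, the two sides differ by the divergence of `ρ.snd` from `q`. The swap is
needed because the chain rule disintegrates over the first coordinate; the conditional kernel then
lives on `α`. -/
lemma klDiv_prod_snd_le [StandardBorelSpace α] [Nonempty α] (ρ : Measure (α × β))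
    [IsProbabilityMeasure ρ] (q : Measure β) [IsProbabilityMeasure q] :
    klDiv ρ (ρ.fst.prod ρ.snd) ≤ klDiv ρ (ρ.fst.prod q) := by
  set ρ' := ρ.map Prod.swap with hρ'
  have : IsProbabilityMeasure ρ' := Measure.isProbabilityMeasure_map (by fun_prop)
  have key (r : Measure β) [IsProbabilityMeasure r] :
      klDiv ρ (ρ.fst.prod r) = klDiv ρ' (r.prod ρ.fst) := by
    rw [← klDiv_map_measurableEquiv MeasurableEquiv.prodComm]
    congr 1
    exact Measure.prod_swap
  have hfst : ρ'.fst = ρ.snd := by simp [hρ', Measure.fst_map_swap]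
  rw [key, key, ← Measure.compProd_const, ← Measure.compProd_const]
  have h := klDiv_compProd_eq_add ρ'.fst q ρ'.condKernel (Kernel.const β ρ.fst)
  rw [ρ'.disintegrate ρ'.condKernel, hfst] at h
  rw [h]
  exact le_add_self

end InformationTheory

namespace ComplexChannel

open InformationTheory

lemma mutualInfo_map_prodCongr {α β α' β' : Type*} [MeasurableSpace α] [MeasurableSpace β]
    [MeasurableSpace α'] [MeasurableSpace β'] (b : ℝ) (e : α ≃ᵐ α') (f : β ≃ᵐ β')
    (ρ : Measure (α × β)) [IsProbabilityMeasure ρ] :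
    mutualInfo b (ρ.map (Prod.map e f)) = mutualInfo b ρ := by
  have h1 : (ρ.map (Prod.map e f)).fst = ρ.fst.map e := by
    rw [Measure.fst, Measure.fst, Measure.map_map (by fun_prop) (by fun_prop),
      Measure.map_map (by fun_prop) (by fun_prop)]
    rfl
  have h2 : (ρ.map (Prod.map e f)).snd = ρ.snd.map f := by
    rw [Measure.snd, Measure.snd, Measure.map_map (by fun_prop) (by fun_prop),
      Measure.map_map (by fun_prop) (by fun_prop)]
    rfl
  rw [mutualInfo, mutualInfo, h1, h2, Measure.map_prod_map _ _ e.measurable f.measurable]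
  congr 1
  exact klDiv_map_measurableEquiv (e.prodCongr f) ρ (ρ.fst.prod ρ.snd)

end ComplexChannel

/-! ### Product densities and divergence from an exponential density -/

namespace MeasureTheory

lemma lintegral_pi_prod_eq_prod {ι : Type*} [Fintype ι] {X : ι → Type*}
    [∀ i, MeasurableSpace (X i)] (μ : ∀ i, Measure (X i)) [∀ i, IsProbabilityMeasure (μ i)]
    {f : ∀ i, X i → ℝ≥0∞} (hf : ∀ i, Measurable (f i)) :
    ∫⁻ x, ∏ i, f i (x i) ∂(Measure.pi μ) = ∏ i, ∫⁻ x, f i x ∂(μ i) := by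
  have hind : iIndepFun (fun i (x : ∀ i, X i) => f i (x i)) (Measure.pi μ) :=
    iIndepFun_pi (fun i => (hf i).aemeasurable)
  have h := lintegral_prod_eq_prod_lintegral_of_indepFun Finset.univ _ hind
    (fun i => (hf i).comp (measurable_pi_apply i))
  rw [h]
  refine Finset.prod_congr rfl fun i _ => ?_
  rw [← (measurePreserving_eval μ i).lintegral_comp (hf i)]

lemma Measure.pi_withDensity {ι : Type*} [Fintype ι] {X : ι → Type*}
    [∀ i, MeasurableSpace (X i)] (μ : ∀ i, Measure (X i)) [∀ i, IsProbabilityMeasure (μ i)]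
    {f : ∀ i, X i → ℝ≥0∞} (hf : ∀ i, Measurable (f i))
    [∀ i, SigmaFinite ((μ i).withDensity (f i))] :
    Measure.pi (fun i => (μ i).withDensity (f i))
      = (Measure.pi μ).withDensity (fun x => ∏ i, f i (x i)) := by
  refine Measure.pi_eq (μ := fun i => (μ i).withDensity (f i)) fun s hs => ?_
  have hS := MeasurableSet.univ_pi hs
  rw [withDensity_apply _ hS, ← lintegral_indicator hS]
  have : (Set.univ.pi s).indicator (fun x => ∏ i, f i (x i))
      = fun x => ∏ i, (s i).indicator (f i) (x i) := by
    ext x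
    by_cases hx : x ∈ Set.univ.pi s
    · rw [Set.indicator_of_mem hx]
      exact Finset.prod_congr rfl fun i _ => (Set.indicator_of_mem (hx i trivial) _).symm
    · rw [Set.indicator_of_notMem hx]
      simp only [Set.mem_pi, Set.mem_univ, true_implies, not_forall] at hx
      obtain ⟨i, hi⟩ := hx
      exact (Finset.prod_eq_zero (Finset.mem_univ i) (Set.indicator_of_notMem hi _)).symm
  rw [this, lintegral_pi_prod_eq_prod μ (fun i => (hf i).indicator (hs i))]
  refine Finset.prod_congr rfl fun i _ => ?_
  rw [lintegral_indicator (hs i), withDensity_apply _ (hs i)]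

end MeasureTheory

namespace InformationTheory

/-- The log-likelihood ratio is `φ` almost everywhere, and the mass correction in `klDiv` vanishes
between probability measures. -/
lemma klDiv_withDensity_exp {α : Type*} [MeasurableSpace α] {p q : Measure α}
    [IsProbabilityMeasure p] [IsProbabilityMeasure q] {φ : α → ℝ} (hφ : Measurable φ)
    (hp : p = q.withDensity (fun x => ENNReal.ofReal (Real.exp (φ x)))) (hint : Integrable φ p) :
    klDiv p q = ENNReal.ofReal (∫ x, φ x ∂p) := by
  have hac : p ≪ q := hp ▸ withDensity_absolutelyContinuous _ _
  have hllr : llr p q =ᵐ[p] φ := by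
    have h : p.rnDeriv q =ᵐ[q] fun x => ENNReal.ofReal (Real.exp (φ x)) := by
      conv_lhs => rw [hp]
      exact Measure.rnDeriv_withDensity _ (by fun_prop)
    filter_upwards [hac.ae_le h] with x hx
    rw [llr, hx, ENNReal.toReal_ofReal (Real.exp_pos _).le, Real.log_exp]
  rw [klDiv_of_ac_of_integrable hac (hint.congr hllr.symm), integral_congr_ae hllr]
  simp

end InformationTheory

/-! ### Gaussian vectors with independent real entries -/

namespace ProbabilityTheory

open scoped NNReal

/-- The ratio √(s/d) of normalizing constants is moved into the exponent, so that log-densities add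
over coordinates. -/
lemma gaussianReal_eq_withDensity_gaussianReal (m : ℝ) {d s : ℝ≥0} (hd : d ≠ 0) (hs : s ≠ 0) :
    gaussianReal m d = (gaussianReal 0 s).withDensity (fun y => ENNReal.ofReal
      (Real.exp (1 / 2 * Real.log (s / d) - (y - m) ^ 2 / (2 * d) + y ^ 2 / (2 * s)))) := by
  rw [gaussianReal_of_var_ne_zero _ hd, gaussianReal_of_var_ne_zero _ hs,
    ← withDensity_mul _ (measurable_gaussianPDF _ _) (by fun_prop)]
  congr 1
  ext y
  rw [Pi.mul_apply, gaussianPDF, gaussianPDF,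
    ← ENNReal.ofReal_mul (gaussianPDFReal_nonneg _ _ _), gaussianPDFReal, gaussianPDFReal]
  congr 1
  have hd' : (0 : ℝ) < d := by positivity
  have hs' : (0 : ℝ) < s := by positivity
  have hlog : Real.exp (1 / 2 * Real.log (s / d)) = √s / √d := by
    rw [← Real.sqrt_div hs'.le, Real.sqrt_eq_rpow, Real.rpow_def_of_pos (by positivity), mul_comm]
  rw [Real.exp_add, Real.exp_sub, hlog,
    Real.sqrt_mul (x := 2 * Real.pi) (by positivity) (d : ℝ),
    Real.sqrt_mul (x := 2 * Real.pi) (by positivity) (s : ℝ)]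
  rw [neg_div, neg_div, Real.exp_neg, Real.exp_neg, sub_zero]
  field_simp

variable {ι : Type*} [Fintype ι]

lemma pi_gaussianReal_map_add_left (d : ι → ℝ≥0) (x : ι → ℝ) :
    (Measure.pi fun i => gaussianReal 0 (d i)).map (x + ·)
      = Measure.pi fun i => gaussianReal (x i) (d i) := by
  have h := Measure.pi_map_pi (μ := fun i => gaussianReal 0 (d i))
    (f := fun i (y : ℝ) => x i + y) (fun i => by fun_prop)
  simp_rw [gaussianReal_map_const_add, zero_add] at h
  exact h

/-- The log-density of `∏ N(xᵢ, dᵢ)` with respect to `∏ N(0, s)`. -/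
noncomputable def gaussianLogRatio (d : ι → ℝ≥0) (s : ℝ≥0) (p : (ι → ℝ) × (ι → ℝ)) : ℝ :=
  ∑ i, (1 / 2 * Real.log (s / d i) - (p.2 i - p.1 i) ^ 2 / (2 * d i) + p.2 i ^ 2 / (2 * s))

lemma measurable_gaussianLogRatio (d : ι → ℝ≥0) (s : ℝ≥0) : Measurable (gaussianLogRatio d s) := by
  unfold gaussianLogRatio
  fun_prop

lemma pi_gaussianReal_eq_withDensity {d : ι → ℝ≥0} {s : ℝ≥0} (hd : ∀ i, d i ≠ 0) (hs : s ≠ 0)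
    (x : ι → ℝ) :
    (Measure.pi fun i => gaussianReal (x i) (d i))
      = (Measure.pi fun _ => gaussianReal 0 s).withDensity
        (fun y => ENNReal.ofReal (Real.exp (gaussianLogRatio d s (x, y)))) := by
  have h (i : ι) := gaussianReal_eq_withDensity_gaussianReal (x i) (hd i) hs
  have hσ (i : ι) : SigmaFinite ((gaussianReal 0 s).withDensity (fun y => ENNReal.ofReal
      (Real.exp (1 / 2 * Real.log (s / d i) - (y - x i) ^ 2 / (2 * d i) + y ^ 2 / (2 * s))))) := by
    rw [← h i]; infer_instance
  simp_rw [h]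
  rw [Measure.pi_withDensity _ (fun i => by fun_prop)]
  congr 1
  ext y
  rw [gaussianLogRatio, Real.exp_sum, ENNReal.ofReal_prod_of_nonneg fun i _ => (Real.exp_pos _).le]

/-- Given x, the output is ∏ N(xᵢ, dᵢ); Fubini carries the fibrewise density to the joint law, for
an arbitrary input law. -/
lemma map_add_eq_withDensity (μ : Measure (ι → ℝ)) [IsProbabilityMeasure μ] {d : ι → ℝ≥0}
    {s : ℝ≥0} (hd : ∀ i, d i ≠ 0) (hs : s ≠ 0) :
    (μ.prod (Measure.pi fun i => gaussianReal 0 (d i))).map (fun p => (p.1, p.1 + p.2))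
      = (μ.prod (Measure.pi fun _ => gaussianReal 0 s)).withDensity
        (fun p => ENNReal.ofReal (Real.exp (gaussianLogRatio d s p))) := by
  have hm := measurable_gaussianLogRatio d s
  refine Measure.ext_of_lintegral _ fun f hf => ?_
  have hg : Measurable (fun p => ENNReal.ofReal (Real.exp (gaussianLogRatio d s p))) := by fun_prop
  have hT : Measurable (fun p : (ι → ℝ) × (ι → ℝ) => (p.1, p.1 + p.2)) := by fun_prop
  rw [lintegral_map hf hT, lintegral_prod (fun p => f (p.1, p.1 + p.2))
      (hf.comp hT).aemeasurable,
    lintegral_withDensity_eq_lintegral_mul _ hg hf, lintegral_prod _ (hg.mul hf).aemeasurable]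
  refine lintegral_congr fun x => ?_
  calc ∫⁻ w, f (x, x + w) ∂(Measure.pi fun i => gaussianReal 0 (d i))
      = ∫⁻ y, f (x, y) ∂((Measure.pi fun i => gaussianReal 0 (d i)).map (x + ·)) :=
        (lintegral_map (f := fun y => f (x, y)) (by fun_prop) (by fun_prop)).symm
    _ = _ := by
        rw [pi_gaussianReal_map_add_left, pi_gaussianReal_eq_withDensity hd hs,
          lintegral_withDensity_eq_lintegral_mul _ (by fun_prop) (by fun_prop)]
        rfl

lemma memLp_eval_pi_gaussianReal (d : ι → ℝ≥0) (i : ι) :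
    MemLp (fun x : ι → ℝ => x i) 2 (Measure.pi fun i => gaussianReal 0 (d i)) :=
  (memLp_id_gaussianReal' (μ := 0) (v := d i) 2 (by simp)).comp_measurePreserving
    (measurePreserving_eval (fun i => gaussianReal 0 (d i)) i)

lemma integral_eval_pi_gaussianReal (d : ι → ℝ≥0) (i : ι) :
    ∫ x, x i ∂(Measure.pi fun i => gaussianReal 0 (d i)) = 0 := by
  rw [integral_eval (μ := fun i => gaussianReal 0 (d i))]
  exact integral_id_gaussianReal

lemma integral_sq_gaussianReal_zero (v : ℝ≥0) : ∫ x, x ^ 2 ∂(gaussianReal 0 v) = v := by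
  have h := variance_fun_id_gaussianReal (μ := 0) (v := v)
  rw [variance_eq_integral measurable_id'.aemeasurable] at h
  simpa using h

lemma integral_eval_mul_eval_pi_gaussianReal [DecidableEq ι] (d : ι → ℝ≥0) (i j : ι) :
    ∫ x, x i * x j ∂(Measure.pi fun i => gaussianReal 0 (d i)) = if i = j then (d i : ℝ) else 0 := by
  split_ifs with h
  · subst h
    rw [integral_comp_eval (μ := fun i => gaussianReal 0 (d i)) (i := i) (f := fun y : ℝ => y * y)
      (by fun_prop)]
    simp_rw [← sq]
    exact integral_sq_gaussianReal_zero _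
  · have hind := (iIndepFun_pi (μ := fun i => gaussianReal 0 (d i)) (X := fun _ (x : ℝ) => x)
      (fun i => aemeasurable_id)).indepFun h
    rw [hind.integral_fun_mul_eq_mul_integral (memLp_eval_pi_gaussianReal d i).1
      (memLp_eval_pi_gaussianReal d j).1]
    simp [integral_eval_pi_gaussianReal]

/-- In terms of x and the noise w the log-ratio is quadratic, and the cross terms xᵢwᵢ have mean
zero. The input law thus enters only through its power. -/
lemma integral_gaussianLogRatio (μ : Measure (ι → ℝ)) [IsProbabilityMeasure μ] {d : ι → ℝ≥0}
    {s : ℝ≥0} (hd : ∀ i, d i ≠ 0) (hs : s ≠ 0) (hμ : ∀ i, MemLp (fun x => x i) 2 μ) :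
    HasFiniteIntegral (fun p => gaussianLogRatio d s (p.1, p.1 + p.2))
        (μ.prod (Measure.pi fun i => gaussianReal 0 (d i))) ∧
    ∫ p, gaussianLogRatio d s (p.1, p.1 + p.2) ∂(μ.prod (Measure.pi fun i => gaussianReal 0 (d i)))
      = 1 / 2 * ∑ i, Real.log (s / d i)
        + (∑ i, ∫ x, x i ^ 2 ∂μ + ∑ i, (d i : ℝ) - Fintype.card ι * s) / (2 * s) := by
  classical
  set ν := Measure.pi fun i => gaussianReal 0 (d i) with hν
  have hs' : (0 : ℝ) < s := by positivity
  have ix (i) : Integrable (fun p : (ι → ℝ) × (ι → ℝ) => p.1 i ^ 2) (μ.prod ν) :=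
    (hμ i).integrable_sq.comp_fst ν
  have iw (i) : Integrable (fun p : (ι → ℝ) × (ι → ℝ) => p.2 i ^ 2) (μ.prod ν) :=
    (memLp_eval_pi_gaussianReal d i).integrable_sq.comp_snd μ
  have ixw (i) : Integrable (fun p : (ι → ℝ) × (ι → ℝ) => p.1 i * p.2 i) (μ.prod ν) :=
    ((hμ i).integrable (by simp)).mul_prod ((memLp_eval_pi_gaussianReal d i).integrable (by simp))
  have expand : (fun p : (ι → ℝ) × (ι → ℝ) => gaussianLogRatio d s (p.1, p.1 + p.2))
      = fun p => ∑ i, ((1 / 2 * Real.log (s / d i) + (1 / (2 * s) - 1 / (2 * d i)) * p.2 i ^ 2)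
          + (1 / (2 * s) * p.1 i ^ 2 + 1 / s * (p.1 i * p.2 i))) := by
    ext p
    refine Finset.sum_congr rfl fun i _ => ?_
    simp only [Pi.add_apply, add_sub_cancel_left]
    have : (d i : ℝ) ≠ 0 := by exact_mod_cast hd i
    field_simp
    ring
  have i1 (i) : Integrable (fun p : (ι → ℝ) × (ι → ℝ) =>
      1 / 2 * Real.log (s / d i) + (1 / (2 * s) - 1 / (2 * d i)) * p.2 i ^ 2) (μ.prod ν) :=
    (integrable_const _).add ((iw i).const_mul _)
  have i2 (i) : Integrable (fun p : (ι → ℝ) × (ι → ℝ) =>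
      1 / (2 * s) * p.1 i ^ 2 + 1 / s * (p.1 i * p.2 i)) (μ.prod ν) :=
    ((ix i).const_mul _).add ((ixw i).const_mul _)
  have i3 (i) : Integrable (fun p : (ι → ℝ) × (ι → ℝ) =>
      ((1 / 2 * Real.log (s / d i) + (1 / (2 * s) - 1 / (2 * d i)) * p.2 i ^ 2)
        + (1 / (2 * s) * p.1 i ^ 2 + 1 / s * (p.1 i * p.2 i)))) (μ.prod ν) := (i1 i).add (i2 i)
  rw [expand]
  refine ⟨(integrable_finsetSum _ fun i _ => i3 i).2, ?_⟩
  rw [integral_finsetSum _ fun i _ => i3 i]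
  have hterm (i) : ∫ p : (ι → ℝ) × (ι → ℝ),
      ((1 / 2 * Real.log (s / d i) + (1 / (2 * s) - 1 / (2 * d i)) * p.2 i ^ 2)
          + (1 / (2 * s) * p.1 i ^ 2 + 1 / s * (p.1 i * p.2 i))) ∂(μ.prod ν)
      = 1 / 2 * Real.log (s / d i) + (∫ x, x i ^ 2 ∂μ + d i - s) / (2 * s) := by
    have e1 : ∫ p : (ι → ℝ) × (ι → ℝ), p.1 i * p.2 i ∂(μ.prod ν) = 0 := by
      rw [integral_prod_mul (μ := μ) (ν := ν) (fun x : ι → ℝ => x i) (fun x : ι → ℝ => x i),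
        integral_eval_pi_gaussianReal, mul_zero]
    have e2 : ∫ p : (ι → ℝ) × (ι → ℝ), p.1 i ^ 2 ∂(μ.prod ν) = ∫ x, x i ^ 2 ∂μ := by
      simpa using integral_fun_fst (μ := μ) (ν := ν) (fun x : ι → ℝ => x i ^ 2)
    have e3 : ∫ p : (ι → ℝ) × (ι → ℝ), p.2 i ^ 2 ∂(μ.prod ν) = ∫ x, x i ^ 2 ∂ν := by
      simpa using integral_fun_snd (μ := μ) (ν := ν) (fun x : ι → ℝ => x i ^ 2)
    rw [integral_add (i1 i) (i2 i), integral_add (integrable_const _) ((iw i).const_mul _),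
      integral_add ((ix i).const_mul _) ((ixw i).const_mul _)]
    simp only [integral_const_mul, e1, e2, e3]
    have := integral_eval_mul_eval_pi_gaussianReal d i i
    simp_rw [← sq, if_true] at this
    rw [this]
    have : (d i : ℝ) ≠ 0 := by exact_mod_cast hd i
    simp
    field_simp
    ring
  simp_rw [hterm]
  rw [Finset.sum_add_distrib, ← Finset.mul_sum, ← Finset.sum_div, Finset.sum_sub_distrib,
    Finset.sum_add_distrib]
  simp

open InformationTheory in
lemma klDiv_map_add_prod_gaussian (μ : Measure (ι → ℝ)) [IsProbabilityMeasure μ] {d : ι → ℝ≥0}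
    {s : ℝ≥0} (hd : ∀ i, d i ≠ 0) (hs : s ≠ 0) (hμ : ∀ i, MemLp (fun x => x i) 2 μ) :
    klDiv ((μ.prod (Measure.pi fun i => gaussianReal 0 (d i))).map (fun p => (p.1, p.1 + p.2)))
        (μ.prod (Measure.pi fun _ => gaussianReal 0 s))
      = ENNReal.ofReal (1 / 2 * ∑ i, Real.log (s / d i)
        + (∑ i, ∫ x, x i ^ 2 ∂μ + ∑ i, (d i : ℝ) - Fintype.card ι * s) / (2 * s)) := by
  have hm := measurable_gaussianLogRatio d s
  have hT : Measurable (fun p : (ι → ℝ) × (ι → ℝ) => (p.1, p.1 + p.2)) := by fun_prop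
  have : IsProbabilityMeasure ((μ.prod (Measure.pi fun i => gaussianReal 0 (d i))).map
    (fun p => (p.1, p.1 + p.2))) := Measure.isProbabilityMeasure_map hT.aemeasurable
  obtain ⟨hfin, hval⟩ := integral_gaussianLogRatio μ hd hs hμ
  rw [klDiv_withDensity_exp hm (map_add_eq_withDensity μ hd hs)]
  · rw [integral_map hT.aemeasurable hm.aestronglyMeasurable, hval]
  · rw [integrable_map_measure hm.aestronglyMeasurable hT.aemeasurable]
    exact ⟨(hm.comp hT).aestronglyMeasurable, hfin⟩

lemma map_add_prod_pi_gaussianReal (d e : ι → ℝ≥0) :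
    ((Measure.pi fun i => gaussianReal 0 (d i)).prod (Measure.pi fun i => gaussianReal 0 (e i))).map
      (fun p => p.1 + p.2) = Measure.pi fun i => gaussianReal 0 (d i + e i) := by
  have h := (measurePreserving_arrowProdEquivProdArrow ℝ ℝ ι (fun i => gaussianReal 0 (d i))
    (fun i => gaussianReal 0 (e i))).map_eq
  rw [← h, Measure.map_map (by fun_prop) (MeasurableEquiv.measurable _)]
  have h2 := Measure.pi_map_pi (μ := fun i => (gaussianReal 0 (d i)).prod (gaussianReal 0 (e i)))
    (f := fun i (p : ℝ × ℝ) => p.1 + p.2) (fun i => by fun_prop)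
  have h3 (i : ι) : ((gaussianReal 0 (d i)).prod (gaussianReal 0 (e i))).map
      (fun p : ℝ × ℝ => p.1 + p.2) = gaussianReal 0 (d i + e i) := by
    have := gaussianReal_conv_gaussianReal (m₁ := 0) (m₂ := 0) (v₁ := d i) (v₂ := e i)
    rwa [add_zero] at this
  simp_rw [h3] at h2
  exact h2

end ProbabilityTheory

/-! ### Complex Gaussian laws and their real-linear images -/

namespace ComplexChannel

open scoped NNReal ComplexConjugate

variable {n : ℕ} {ι : Type*} [Fintype ι]

lemma IsZeroMeanGaussian.integral_eval {μ : Measure (Fin n → ℂ)} {C P : Matrix (Fin n) (Fin n) ℂ}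
    (h : IsZeroMeanGaussian μ C P) (i : Fin n) : ∫ x, x i ∂μ = 0 := congrFun h.mean_eq i

lemma IsZeroMeanGaussian.integral_mul_conj {μ : Measure (Fin n → ℂ)}
    {C P : Matrix (Fin n) (Fin n) ℂ} (h : IsZeroMeanGaussian μ C P) (i j : Fin n) :
    ∫ x, x i * conj (x j) ∂μ = C i j := by
  have := congrFun (congrFun h.cov_eq i) j
  simpa [covMatrix, h.mean_eq] using this

lemma IsZeroMeanGaussian.integral_mul {μ : Measure (Fin n → ℂ)}
    {C P : Matrix (Fin n) (Fin n) ℂ} (h : IsZeroMeanGaussian μ C P) (i j : Fin n) :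
    ∫ x, x i * x j ∂μ = P i j := by
  have := congrFun (congrFun h.compCov_eq i) j
  simpa [compCovMatrix, h.mean_eq] using this

lemma IsZeroMeanGaussian.transpose_compCov {μ : Measure (Fin n → ℂ)}
    {C P : Matrix (Fin n) (Fin n) ℂ} (h : IsZeroMeanGaussian μ C P) : Pᵀ = P := by
  ext i j
  rw [Matrix.transpose_apply, ← h.integral_mul, ← h.integral_mul]
  simp_rw [mul_comm]

lemma memLp_eval_of_isGaussian {μ : Measure (Fin n → ℂ)} (h : IsGaussian μ) (i : Fin n) :
    MemLp (fun x => x i) 2 μ :=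
  (ContinuousLinearMap.proj (R := ℝ) (φ := fun _ : Fin n => ℂ) i).comp_memLp' h.memLp_two_id

/-- Puts real functionals in the form Re(cᵀx), whose second moments are expressible by `C` and `P`.
-/
lemma strongDual_apply_eq_re (L : StrongDual ℝ (Fin n → ℂ)) (x : Fin n → ℂ) :
    L x = (∑ i, (L (Pi.single i 1) - L (Pi.single i Complex.I) * Complex.I) * x i).re := by
  have hx : x = ∑ i, ((x i).re • (Pi.single i 1 : Fin n → ℂ)
      + (x i).im • (Pi.single i Complex.I : Fin n → ℂ)) := by
    ext j
    simp [Finset.sum_apply, Pi.single_apply, Finset.sum_add_distrib]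
  conv_lhs => rw [hx]
  simp [map_sum, Complex.re_sum, mul_comm]

lemma integral_complex_re {α : Type*} [MeasurableSpace α] {μ : Measure α} {f : α → ℂ}
    (hf : Integrable f μ) : ∫ x, (f x).re ∂μ = (∫ x, f x ∂μ).re :=
  integral_re hf

lemma IsZeroMeanGaussian.integral_strongDual {μ : Measure (Fin n → ℂ)}
    {C P : Matrix (Fin n) (Fin n) ℂ} (h : IsZeroMeanGaussian μ C P)
    (L : StrongDual ℝ (Fin n → ℂ)) : ∫ x, L x ∂μ = 0 := by
  have hint (i) : Integrable (fun x : Fin n → ℂ => x i) μ :=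
    have := h.gaussian
    (memLp_eval_of_isGaussian h.gaussian i).integrable (by simp)
  refine (integral_congr_ae (ae_of_all _ (strongDual_apply_eq_re L))).trans ?_
  rw [integral_complex_re (integrable_finsetSum _ fun i _ => (hint i).const_mul _),
    integral_finsetSum _ fun i _ => (hint i).const_mul _]
  simp [integral_const_mul, h.integral_eval]

/-- From (Re u)² = ½ Re(uū + uu): the first product yields `C`, the second `P`. -/
lemma IsZeroMeanGaussian.integral_strongDual_sq {μ : Measure (Fin n → ℂ)}
    {C P : Matrix (Fin n) (Fin n) ℂ} (h : IsZeroMeanGaussian μ C P)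
    (L : StrongDual ℝ (Fin n → ℂ)) (c : Fin n → ℂ) (hL : ∀ x, L x = (∑ i, c i * x i).re) :
    ∫ x, L x ^ 2 ∂μ = 1 / 2 * (∑ i, ∑ j, (c i * conj (c j) * C i j + c i * c j * P i j)).re := by
  have hLp (i) := memLp_eval_of_isGaussian h.gaussian i
  have i1 (i j) : Integrable (fun x : Fin n → ℂ => x i * conj (x j)) μ :=
    (hLp i).integrable_mul (hLp j).star
  have i2 (i j) : Integrable (fun x : Fin n → ℂ => x i * x j) μ := (hLp i).integrable_mul (hLp j)
  have i3 (i j) : Integrable (fun x : Fin n → ℂ => c i * conj (c j) * (x i * conj (x j))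
      + c i * c j * (x i * x j)) μ := ((i1 i j).const_mul _).add ((i2 i j).const_mul _)
  have i4 (i) : Integrable (fun x : Fin n → ℂ => ∑ j, (c i * conj (c j) * (x i * conj (x j))
      + c i * c j * (x i * x j))) μ := integrable_finsetSum _ fun j _ => i3 i j
  have hsq (x : Fin n → ℂ) : L x ^ 2 = 1 / 2 * (∑ i, ∑ j, (c i * conj (c j) * (x i * conj (x j))
      + c i * c j * (x i * x j))).re := by
    have hu (u : ℂ) : u.re ^ 2 = 1 / 2 * (u * conj u + u * u).re := by
      simp; ring
    rw [hL, hu, map_sum, Finset.sum_mul_sum, Finset.sum_mul_sum, ← Finset.sum_add_distrib]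
    congr 2
    refine Finset.sum_congr rfl fun i _ => ?_
    rw [← Finset.sum_add_distrib]
    refine Finset.sum_congr rfl fun j _ => ?_
    rw [map_mul]
    ring
  simp_rw [hsq]
  rw [integral_const_mul, integral_complex_re (integrable_finsetSum _ fun i _ => i4 i),
    integral_finsetSum _ fun i _ => i4 i]
  congr 3
  ext i
  rw [integral_finsetSum _ fun j _ => i3 i j]
  refine Finset.sum_congr rfl fun j _ => ?_
  rw [integral_add ((i1 i j).const_mul _) ((i2 i j).const_mul _), integral_const_mul,
    integral_const_mul, h.integral_mul_conj, h.integral_mul]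

/-- A zero-mean complex Gaussian law is determined by its covariance and complementary covariance
matrices. -/
lemma IsZeroMeanGaussian.ext {μ μ' : Measure (Fin n → ℂ)}
    {C P : Matrix (Fin n) (Fin n) ℂ} (h : IsZeroMeanGaussian μ C P)
    (h' : IsZeroMeanGaussian μ' C P) : μ = μ' := by
  have := h.gaussian
  have := h'.gaussian
  -- The characteristic function of a Gaussian law at `L` depends only on the mean and variance of
  -- `L`.
  refine Measure.ext_of_charFunDual (funext fun L => ?_)
  have hvar {ρ : Measure (Fin n → ℂ)} (hρ : IsZeroMeanGaussian ρ C P) :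
      Var[L; ρ] = ∫ x, L x ^ 2 ∂ρ := by
    rw [variance_eq_integral L.continuous.aemeasurable, hρ.integral_strongDual]
    simp
  rw [IsGaussian.charFunDual_eq, IsGaussian.charFunDual_eq, hvar h, hvar h',
    h.integral_strongDual_sq L _ (strongDual_apply_eq_re L),
    h'.integral_strongDual_sq L _ (strongDual_apply_eq_re L),
    integral_complex_ofReal, integral_complex_ofReal, h.integral_strongDual,
    h'.integral_strongDual]

/-- The real-linear map `ℝ^ι → ℂⁿ` given by a complex matrix. -/
noncomputable def realMulVec (T : Matrix (Fin n) ι ℂ) : (ι → ℝ) →L[ℝ] (Fin n → ℂ) :=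
  LinearMap.toContinuousLinearMap
    { toFun := fun x => T *ᵥ fun i => (x i : ℂ)
      map_add' := fun x y => by
        rw [← Matrix.mulVec_add]
        congr 1
        ext i
        simp
      map_smul' := fun r x => by
        rw [RingHom.id_apply, ← Matrix.mulVec_smul]
        congr 1
        ext i
        simp }

lemma realMulVec_apply (T : Matrix (Fin n) ι ℂ) (x : ι → ℝ) :
    realMulVec T x = T *ᵥ fun i => (x i : ℂ) := rfl

lemma isGaussian_pi_gaussianReal (d : ι → ℝ≥0) :
    IsGaussian (Measure.pi fun i => gaussianReal 0 (d i)) := by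
  have h := iIndepFun.hasGaussianLaw (P := Measure.pi fun i => gaussianReal 0 (d i))
    (X := fun i (x : ι → ℝ) => x i) (fun i => ⟨by
      rw [(measurePreserving_eval (fun i => gaussianReal 0 (d i)) i).map_eq]
      infer_instance⟩)
    (iIndepFun_pi (μ := fun i => gaussianReal 0 (d i)) (X := fun _ (x : ℝ) => x)
      (fun i => aemeasurable_id))
  simpa using h.isGaussian_map

lemma isZeroMeanGaussian_map_realMulVec [DecidableEq ι] (T : Matrix (Fin n) ι ℂ) (d : ι → ℝ≥0) :
    IsZeroMeanGaussian ((Measure.pi fun i => gaussianReal 0 (d i)).map (realMulVec T))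
      (T * Matrix.diagonal (fun i => ((d i : ℝ) : ℂ)) * Tᴴ)
      (T * Matrix.diagonal (fun i => ((d i : ℝ) : ℂ)) * Tᵀ) := by
  set π := Measure.pi fun i => gaussianReal 0 (d i) with hπ
  have hg : IsGaussian π := isGaussian_pi_gaussianReal d
  have hT : AEMeasurable (realMulVec T) π := (realMulVec T).continuous.aemeasurable
  have hLp (k : ι) : MemLp (fun x : ι → ℝ => (x k : ℂ)) 2 π :=
    (memLp_eval_pi_gaussianReal d k).ofReal
  have hkl (k l : ι) : ∫ x, (x k : ℂ) * (x l : ℂ) ∂π = if k = l then ((d k : ℝ) : ℂ) else 0 := by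
    have := integral_eval_mul_eval_pi_gaussianReal d k l
    simp_rw [← Complex.ofReal_mul]
    rw [integral_complex_ofReal, this]
    split_ifs <;> simp
  -- Taking `U` to be the conjugate of `T` gives the covariance, and `U = T` the complementary
  -- covariance.
  have hbil (U : Matrix (Fin n) ι ℂ) (i j : Fin n) :
      ∫ x, (∑ k, T i k * (x k : ℂ)) * (∑ l, U j l * (x l : ℂ)) ∂π
        = (T * Matrix.diagonal (fun i => ((d i : ℝ) : ℂ)) * Uᵀ) i j := by
    have e (x : ι → ℝ) : (∑ k, T i k * (x k : ℂ)) * (∑ l, U j l * (x l : ℂ))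
        = ∑ k, ∑ l, T i k * U j l * ((x k : ℂ) * (x l : ℂ)) := by
      rw [Finset.sum_mul_sum]
      refine Finset.sum_congr rfl fun k _ => Finset.sum_congr rfl fun l _ => by ring
    have i1 (k l) : Integrable (fun x : ι → ℝ => T i k * U j l * ((x k : ℂ) * (x l : ℂ))) π :=
      ((hLp k).integrable_mul (hLp l)).const_mul _
    simp_rw [e]
    rw [integral_finsetSum _ fun k _ => integrable_finsetSum _ fun l _ => i1 k l]
    rw [Matrix.mul_apply]
    refine Finset.sum_congr rfl fun k _ => ?_
    rw [integral_finsetSum _ fun l _ => i1 k l]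
    simp_rw [integral_const_mul, hkl]
    simp [Matrix.mul_diagonal]
    ring
  have hmean : meanVec (π.map (realMulVec T)) = 0 := by
    ext i
    rw [meanVec, integral_map hT (measurable_pi_apply i).aestronglyMeasurable]
    simp only [realMulVec_apply, Matrix.mulVec, dotProduct]
    rw [integral_finsetSum _ fun k _ => ((hLp k).integrable (by simp)).const_mul _]
    simp_rw [integral_const_mul, integral_complex_ofReal, hπ, integral_eval_pi_gaussianReal]
    simp
  refine ⟨inferInstance, hmean, ?_, ?_⟩
  · ext i j
    simp only [covMatrix, hmean, Matrix.of_apply, Pi.zero_apply, sub_zero]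
    rw [integral_map hT (by fun_prop), show Tᴴ = (T.map conj)ᵀ from rfl, ← hbil]
    simp [realMulVec_apply, Matrix.mulVec, dotProduct]
  · ext i j
    simp only [compCovMatrix, hmean, Matrix.of_apply, Pi.zero_apply, sub_zero]
    rw [integral_map hT (by fun_prop), ← hbil]
    simp [realMulVec_apply, Matrix.mulVec, dotProduct]

end ComplexChannel

/-! ### The real covariance matrix: eigenvalue bounds and determinant -/

namespace ComplexChannel

open scoped ComplexConjugate

variable {n : ℕ}

lemma norm_star_dotProduct_mulVec_le (A : Matrix (Fin n) (Fin n) ℂ) (u v : Fin n → ℂ) :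
    ‖star u ⬝ᵥ A *ᵥ v‖ ≤ opNorm₂ A * √(∑ i, ‖u i‖ ^ 2) * √(∑ i, ‖v i‖ ^ 2) := by
  have h1 : star u ⬝ᵥ A *ᵥ v = inner ℂ (WithLp.toLp 2 u)
      (Matrix.toEuclideanCLM (n := Fin n) (𝕜 := ℂ) A (WithLp.toLp 2 v)) := by
    rw [EuclideanSpace.inner_eq_star_dotProduct, dotProduct_comm]
    simp
  rw [h1]
  refine (norm_inner_le_norm _ _).trans ?_
  have h2 := (Matrix.toEuclideanCLM (n := Fin n) (𝕜 := ℂ) A).le_opNorm (WithLp.toLp 2 v)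
  rw [EuclideanSpace.norm_eq (WithLp.toLp 2 v)] at h2
  rw [EuclideanSpace.norm_eq (WithLp.toLp 2 u)]
  calc _ ≤ √(∑ i, ‖u i‖ ^ 2) * (‖Matrix.toEuclideanCLM (n := Fin n) (𝕜 := ℂ) A‖
        * √(∑ i, ‖v i‖ ^ 2)) := by gcongr
    _ = _ := by rw [opNorm₂]; ring

/-- The characteristic polynomial of MᴴM, whose roots are the squared singular values, evaluated at
1. -/
lemma det_one_sub_conjTranspose_mul_self (M : Matrix (Fin n) (Fin n) ℂ) :
    (1 - Mᴴ * M).det = ((∏ i, (1 - singularValue M i ^ 2) : ℝ) : ℂ) := by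
  set T := Matrix.toEuclideanLin M with hT
  have hn : Module.finrank ℂ (EuclideanSpace ℂ (Fin n)) = n := by simp
  have hch := T.isSymmetric_adjoint_comp_self.charpoly_eq hn
  have h1 : T.adjoint ∘ₗ T = Matrix.toEuclideanLin (Mᴴ * M) := by
    rw [hT, ← Matrix.toEuclideanLin_conjTranspose_eq_adjoint]
    ext1 v
    simp [Matrix.toLpLin_apply, Matrix.mulVec_mulVec]
  have h2 : (Matrix.toEuclideanLin (Mᴴ * M)).charpoly = (Mᴴ * M).charpoly := by
    rw [Matrix.toEuclideanLin, Matrix.toLpLin_eq_toLin]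
    exact Matrix.charpoly_toLin _ (PiLp.basisFun 2 ℂ (Fin n))
  have h3 := (congrArg LinearMap.charpoly h1).symm.trans hch
  rw [h2] at h3
  have h4 := congrArg (Polynomial.eval 1) h3
  rw [Matrix.eval_charpoly, map_one] at h4
  rw [h4, Polynomial.eval_prod, Complex.ofReal_prod]
  refine Finset.prod_congr rfl fun i _ => ?_
  rw [singularValue, LinearMap.sq_singularValues_fin _ hn]
  simp

/-- The matrix of `ℝⁿ × ℝⁿ → ℂⁿ`, `(a, b) ↦ a + i b`. -/
noncomputable def reIm (n : ℕ) : Matrix (Fin n) (Fin n ⊕ Fin n) ℂ :=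
  Matrix.fromCols 1 (Complex.I • 1)

lemma reIm_mul_conjTranspose : reIm n * (reIm n)ᴴ = (2 : ℂ) • 1 := by
  rw [reIm, Matrix.conjTranspose_fromCols_eq_fromRows_conjTranspose, Matrix.fromCols_mul_fromRows]
  simp [smul_smul, two_smul]

lemma reIm_mul_transpose : reIm n * (reIm n)ᵀ = 0 := by
  rw [reIm, Matrix.transpose_fromCols, Matrix.fromCols_mul_fromRows]
  simp [smul_smul]

lemma reIm_conj_mul_conjTranspose : (reIm n)ᴴᵀ * (reIm n)ᴴ = 0 := by
  have := congrArg Matrix.conjTranspose (reIm_mul_transpose (n := n))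
  rwa [Matrix.conjTranspose_mul, Matrix.conjTranspose_zero] at this

lemma reIm_conj_mul_transpose : (reIm n)ᴴᵀ * (reIm n)ᵀ = (2 : ℂ) • 1 := by
  have := congrArg Matrix.transpose (reIm_mul_conjTranspose (n := n))
  simpa [Matrix.transpose_mul] using this

lemma sum_norm_sq_reIm_mulVec (v : Fin n ⊕ Fin n → ℝ) :
    ∑ i, ‖(reIm n *ᵥ fun k => (v k : ℂ)) i‖ ^ 2 = ∑ k, v k ^ 2 := by
  rw [Fintype.sum_sum_type, ← Finset.sum_add_distrib]
  refine Finset.sum_congr rfl fun i _ => ?_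
  have : (reIm n *ᵥ fun k => (v k : ℂ)) i = v (Sum.inl i) + Complex.I * v (Sum.inr i) := by
    rw [reIm, Matrix.fromCols_mulVec]
    simp [Matrix.smul_mulVec]
  rw [this, ← Complex.normSq_eq_norm_sq, mul_comm, Complex.normSq_add_mul_I]

/-- Covariance matrix of the real vector `(Re x, Im x)`, in terms of the covariance matrix `C` and
the complementary covariance matrix `P` of `x`. -/
noncomputable def realCov (C P : Matrix (Fin n) (Fin n) ℂ) :
    Matrix (Fin n ⊕ Fin n) (Fin n ⊕ Fin n) ℝ :=
  (1 / 2 : ℝ) • ((reIm n)ᴴ * C * reIm n + (reIm n)ᴴ * P * (reIm n)ᴴᵀ).map Complex.re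

lemma realCov_isHermitian {C P : Matrix (Fin n) (Fin n) ℂ} (hC : Cᴴ = C) (hP : Pᵀ = P) :
    (realCov C P).IsHermitian := by
  have h1 : ((reIm n)ᴴ * C * reIm n)ᴴ = (reIm n)ᴴ * C * reIm n := by
    simp [Matrix.conjTranspose_mul, hC, Matrix.mul_assoc]
  have h2 : ((reIm n)ᴴ * P * (reIm n)ᴴᵀ)ᵀ = (reIm n)ᴴ * P * (reIm n)ᴴᵀ := by
    simp [Matrix.transpose_mul, hP, Matrix.mul_assoc]
  ext i j
  have e1 := congrArg Complex.re (congrFun (congrFun h1 i) j)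
  have e2 := congrArg Complex.re (congrFun (congrFun h2 i) j)
  rw [Matrix.conjTranspose_apply] at e1
  rw [Matrix.transpose_apply] at e2
  simp only [RCLike.star_def, Complex.conj_re] at e1
  simp [realCov, e1, e2]

/-- Re a = (a + ā)/2 entrywise. With K = `reIm n`, the relations KKᴴ = 2 and KKᵀ = 0 then leave one
of the four terms in each of KRKᴴ and KRKᵀ. -/
lemma ofReal_map_realCov {C P : Matrix (Fin n) (Fin n) ℂ} (hC : Cᴴ = C) (hP : Pᵀ = P) :
    (realCov C P).map Complex.ofReal = (1 / 4 : ℂ) •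
      ((reIm n)ᴴ * C * reIm n + (reIm n)ᴴ * P * (reIm n)ᴴᵀ
        + ((reIm n)ᵀ * Cᵀ * (reIm n)ᴴᵀ + (reIm n)ᵀ * Pᴴ * reIm n)) := by
  have h : (reIm n)ᵀ * Cᵀ * (reIm n)ᴴᵀ + (reIm n)ᵀ * Pᴴ * reIm n
      = ((reIm n)ᴴ * C * reIm n + (reIm n)ᴴ * P * (reIm n)ᴴᵀ)ᴴᵀ := by
    have e : (reIm n)ᴴᵀᴴ = (reIm n)ᵀ := by
      ext i j
      simp
    have hP' : Pᴴᵀ = Pᴴ := by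
      conv_rhs => rw [← hP]
      rfl
    simp only [Matrix.conjTranspose_add, Matrix.transpose_add, Matrix.conjTranspose_mul,
      Matrix.transpose_mul, hC, Matrix.conjTranspose_conjTranspose, Matrix.mul_assoc, hP', e, Matrix.transpose_transpose]
  rw [h]
  ext i j
  simp only [realCov, Matrix.map_apply, Matrix.smul_apply, Matrix.add_apply,
    Matrix.transpose_apply, Matrix.conjTranspose_apply, smul_eq_mul, RCLike.star_def,
    Complex.ofReal_mul, Complex.re_eq_add_conj]
  push_cast
  ring

lemma reIm_mul_realCov_mul_conjTranspose {C P : Matrix (Fin n) (Fin n) ℂ} (hC : Cᴴ = C)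
    (hP : Pᵀ = P) : reIm n * (realCov C P).map Complex.ofReal * (reIm n)ᴴ = C := by
  rw [ofReal_map_realCov hC hP]
  simp only [Matrix.mul_smul, Matrix.smul_mul, Matrix.mul_add, Matrix.add_mul, ← Matrix.mul_assoc,
    reIm_mul_conjTranspose, reIm_mul_transpose, Matrix.zero_mul, add_zero, Matrix.one_mul]
  simp only [Matrix.mul_assoc, reIm_mul_conjTranspose, reIm_conj_mul_conjTranspose, Matrix.mul_zero,
    Matrix.mul_smul, Matrix.mul_one, smul_zero, add_zero, smul_smul]
  norm_num

lemma reIm_mul_realCov_mul_transpose {C P : Matrix (Fin n) (Fin n) ℂ} (hC : Cᴴ = C)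
    (hP : Pᵀ = P) : reIm n * (realCov C P).map Complex.ofReal * (reIm n)ᵀ = P := by
  rw [ofReal_map_realCov hC hP]
  simp only [Matrix.mul_smul, Matrix.smul_mul, Matrix.mul_add, Matrix.add_mul, ← Matrix.mul_assoc,
    reIm_mul_conjTranspose, reIm_mul_transpose, Matrix.zero_mul, add_zero, Matrix.one_mul]
  simp only [Matrix.mul_assoc, reIm_mul_transpose, reIm_conj_mul_transpose, Matrix.mul_zero,
    Matrix.mul_smul, Matrix.mul_one, smul_zero, zero_add, smul_smul]
  norm_num

lemma realCov_quadForm (C P : Matrix (Fin n) (Fin n) ℂ) (v : Fin n ⊕ Fin n → ℝ)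
    (w : Fin n → ℂ) (hw : w = reIm n *ᵥ fun k => (v k : ℂ)) :
    v ⬝ᵥ realCov C P *ᵥ v = 1 / 2 * (star w ⬝ᵥ C *ᵥ w + star w ⬝ᵥ P *ᵥ star w).re := by
  set vc : Fin n ⊕ Fin n → ℂ := fun k => (v k : ℂ) with hvc
  have hstar : star vc = vc := by ext k; simp [hvc]
  have h1 : star w = vc ᵥ* (reIm n)ᴴ := by rw [hw, Matrix.star_mulVec, hstar]
  have h2 : star w = (reIm n)ᴴᵀ *ᵥ vc := by rw [h1, Matrix.mulVec_transpose]
  have h3 : star w ⬝ᵥ C *ᵥ w + star w ⬝ᵥ P *ᵥ star w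
      = vc ⬝ᵥ ((reIm n)ᴴ * C * reIm n + (reIm n)ᴴ * P * (reIm n)ᴴᵀ) *ᵥ vc := by
    rw [Matrix.add_mulVec, dotProduct_add]
    congr 1
    · rw [h1, hw, ← Matrix.dotProduct_mulVec, Matrix.mulVec_mulVec, Matrix.mulVec_mulVec,
        Matrix.mul_assoc]
    · nth_rw 1 [h1]
      rw [h2, ← Matrix.dotProduct_mulVec, Matrix.mulVec_mulVec, Matrix.mulVec_mulVec,
        Matrix.mul_assoc]
  rw [h3, realCov]
  simp only [dotProduct, Matrix.mulVec, Complex.re_sum, hvc, Matrix.smul_apply, Matrix.map_apply,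
    Complex.re_ofReal_mul, Complex.re_mul_ofReal, Finset.mul_sum, smul_eq_mul]
  refine Finset.sum_congr rfl fun i _ => Finset.sum_congr rfl fun j _ => by ring

lemma star_dotProduct_self_eq (u : Fin n → ℂ) : star u ⬝ᵥ u = ((∑ i, ‖u i‖ ^ 2 : ℝ) : ℂ) := by
  simp [dotProduct, Complex.conj_mul']

/-- With u = Bᴴw the form is ½(‖u‖² + Re(uᴴMū)). Since ‖M‖ < 1, it lies strictly between 0 and ‖u‖²
= wᴴBBᴴw ≤ ‖BBᴴ‖ < s. -/
lemma realCov_quadForm_pos_lt {B M : Matrix (Fin n) (Fin n) ℂ} (hB : B.det ≠ 0)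
    (hM : opNorm₂ M < 1) {s : ℝ} (hs : opNorm₂ (B * Bᴴ) < s) (v : Fin n ⊕ Fin n → ℝ)
    (hv : ∑ k, v k ^ 2 = 1) :
    0 < v ⬝ᵥ realCov (B * Bᴴ) (B * M * Bᵀ) *ᵥ v ∧
      v ⬝ᵥ realCov (B * Bᴴ) (B * M * Bᵀ) *ᵥ v < s := by
  set w := reIm n *ᵥ fun k => (v k : ℂ) with hw
  have hw1 : ∑ i, ‖w i‖ ^ 2 = 1 := by rw [hw, sum_norm_sq_reIm_mulVec, hv]
  set u := Bᴴ *ᵥ w with hu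
  have hsu : star u = star w ᵥ* B := by rw [hu, Matrix.star_mulVec, Matrix.conjTranspose_conjTranspose]
  have hsu' : star u = Bᵀ *ᵥ star w := by rw [hsu, Matrix.mulVec_transpose]
  have e1 : star w ⬝ᵥ (B * Bᴴ) *ᵥ w = ((∑ i, ‖u i‖ ^ 2 : ℝ) : ℂ) := by
    rw [← star_dotProduct_self_eq, ← Matrix.mulVec_mulVec, Matrix.dotProduct_mulVec, ← hsu]
  have e2 : star w ⬝ᵥ (B * M * Bᵀ) *ᵥ star w = star u ⬝ᵥ M *ᵥ star u := by
    rw [← Matrix.mulVec_mulVec, ← Matrix.mulVec_mulVec, Matrix.dotProduct_mulVec, ← hsu, ← hsu']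
  have hupos : 0 < ∑ i, ‖u i‖ ^ 2 := by
    refine lt_of_le_of_ne (by positivity) fun h0 => ?_
    have hu0 : u = 0 := by
      ext i
      have := (Finset.sum_eq_zero_iff_of_nonneg (fun i _ => by positivity)).1 h0.symm i
        (Finset.mem_univ i)
      simpa using this
    have hw0 : w = 0 := by
      refine Matrix.eq_zero_of_mulVec_eq_zero (M := Bᴴ) ?_ hu0
      rw [Matrix.det_conjTranspose]
      simpa using hB
    simp [hw0] at hw1
  have b1 := norm_star_dotProduct_mulVec_le M u (star u)
  simp only [Pi.star_apply, norm_star] at b1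
  rw [mul_assoc, Real.mul_self_sqrt hupos.le] at b1
  have b2 := norm_star_dotProduct_mulVec_le (B * Bᴴ) w w
  rw [hw1, e1, Complex.norm_real, Real.norm_of_nonneg hupos.le] at b2
  simp only [Real.sqrt_one, mul_one] at b2
  have b3 := abs_le.1 ((Complex.abs_re_le_norm _).trans b1)
  rw [realCov_quadForm _ _ v w hw, e1, e2, Complex.add_re, Complex.ofReal_re]
  constructor <;> nlinarith

/-- Factor as diag(B, B̄) · [1 M; Mᴴ 1] · diag(Bᴴ, Bᵀ); a Schur complement turns the middle
determinant into det(1 − MᴴM). -/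
lemma det_fromBlocks_augmented {B M : Matrix (Fin n) (Fin n) ℂ} (hM : Mᵀ = M) :
    (Matrix.fromBlocks (B * Bᴴ) (B * M * Bᵀ) (B * M * Bᵀ)ᴴᵀ (B * Bᴴ)ᴴᵀ).det
      = ((‖B.det‖ ^ 4 * ∏ i, (1 - singularValue M i ^ 2) : ℝ) : ℂ) := by
  have hM' : Mᴴᵀ = Mᴴ := by
    conv_rhs => rw [← hM]
    rfl
  have key : Matrix.fromBlocks (B * Bᴴ) (B * M * Bᵀ) (B * M * Bᵀ)ᴴᵀ (B * Bᴴ)ᴴᵀ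
      = Matrix.fromBlocks B 0 0 Bᴴᵀ * Matrix.fromBlocks 1 M Mᴴ 1 * Matrix.fromBlocks Bᴴ 0 0 Bᵀ := by
    rw [Matrix.fromBlocks_multiply, Matrix.fromBlocks_multiply]
    have e : Bᵀᴴᵀ = Bᴴ := rfl
    simp [Matrix.conjTranspose_mul, Matrix.transpose_mul, hM', e, Matrix.mul_assoc]
  rw [key, Matrix.det_mul, Matrix.det_mul, Matrix.det_fromBlocks_zero₂₁,
    Matrix.det_fromBlocks_zero₂₁, Matrix.det_fromBlocks_one₁₁, det_one_sub_conjTranspose_mul_self,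
    Matrix.det_transpose, Matrix.det_transpose, Matrix.det_conjTranspose]
  have : B.det * star B.det = ((‖B.det‖ ^ 2 : ℝ) : ℂ) := by
    simp [Complex.mul_conj']
  have e : B.det * star B.det * ((∏ i, (1 - singularValue M i ^ 2) : ℝ) : ℂ) * (star B.det * B.det)
      = (B.det * star B.det) ^ 2 * ((∏ i, (1 - singularValue M i ^ 2) : ℝ) : ℂ) := by ring
  rw [e, this]
  push_cast
  ring

/-- For the square matrix W = [K; K̄], WRWᴴ is the augmented matrix and WWᴴ = 2. In dimension 2n the
latter has determinant 4ⁿ. -/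
lemma det_realCov {B M : Matrix (Fin n) (Fin n) ℂ} (hM : Mᵀ = M) :
    4 ^ n * (realCov (B * Bᴴ) (B * M * Bᵀ)).det
      = ‖B.det‖ ^ 4 * ∏ i, (1 - singularValue M i ^ 2) := by
  have hC : (B * Bᴴ)ᴴ = B * Bᴴ := by simp
  have hP : (B * M * Bᵀ)ᵀ = B * M * Bᵀ := by simp [Matrix.transpose_mul, hM, Matrix.mul_assoc]
  set C := B * Bᴴ with hCdef
  set P := B * M * Bᵀ with hPdef
  set R := (realCov C P).map Complex.ofReal with hR
  have hRR : Rᴴᵀ = R := by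
    ext i j
    simp [hR]
  have h1 := reIm_mul_realCov_mul_conjTranspose hC hP
  have h2 := reIm_mul_realCov_mul_transpose hC hP
  rw [← hR] at h1 h2
  set K := reIm n with hK
  have h3 : Kᴴᵀ * R * Kᵀ = Cᴴᵀ := by
    conv_rhs => rw [← h1]
    have hT : Rᴴ = Rᵀ := by
      conv_rhs => rw [← hRR]
      rw [Matrix.transpose_transpose]
    simp [Matrix.conjTranspose_mul, Matrix.transpose_mul, hT, Matrix.mul_assoc]
  have h4 : Kᴴᵀ * R * Kᴴ = Pᴴᵀ := by
    conv_rhs => rw [← h2]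
    have e : Kᵀᴴᵀ = Kᴴ := rfl
    have hT : Rᴴ = Rᵀ := by
      conv_rhs => rw [← hRR]
      rw [Matrix.transpose_transpose]
    simp [Matrix.conjTranspose_mul, Matrix.transpose_mul, hT, e, Matrix.mul_assoc]
  have h5 : Matrix.fromRows K Kᴴᵀ * R * Matrix.fromCols Kᴴ Kᵀ
      = Matrix.fromBlocks C P Pᴴᵀ Cᴴᵀ := by
    rw [Matrix.fromRows_mul, Matrix.fromRows_mul_fromCols, h1, h2, h3, h4]
  have h6 : Matrix.fromRows K Kᴴᵀ * Matrix.fromCols Kᴴ Kᵀ = (2 : ℂ) • 1 := by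
    rw [Matrix.fromRows_mul_fromCols, reIm_mul_conjTranspose, reIm_mul_transpose,
      reIm_conj_mul_conjTranspose, reIm_conj_mul_transpose, ← Matrix.fromBlocks_one,
      Matrix.fromBlocks_smul]
    simp
  have h7 := congrArg Matrix.det h5
  have h8 := congrArg Matrix.det h6
  rw [Matrix.det_mul] at h8
  rw [Matrix.det_mul, Matrix.det_mul, det_fromBlocks_augmented hM, mul_right_comm, h8,
    Matrix.det_smul, Matrix.det_one, mul_one] at h7
  have h9 : R.det = ((realCov C P).det : ℂ) := (Complex.ofRealHom.map_det _).symm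
  rw [h9] at h7
  have h10 : ((2 : ℂ) ^ Fintype.card (Fin n ⊕ Fin n)) = ((4 ^ n : ℝ) : ℂ) := by
    simp only [Fintype.card_sum, Fintype.card_fin]
    push_cast
    rw [← two_mul, pow_mul]
    norm_num
  rw [h10, ← Complex.ofReal_mul] at h7
  exact_mod_cast h7

/-- `T` is `reIm n` times an orthogonal eigenvector matrix of the real covariance, and `d` lists the
eigenvalues. Orthogonality preserves the norm identity and the products TTᴴ = 2, TTᵀ = 0. -/
theorem exists_real_diagonalization {B M : Matrix (Fin n) (Fin n) ℂ} (hB : B.det ≠ 0)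
    (hMt : Mᵀ = M) (hM : opNorm₂ M < 1) {s : ℝ} (hs : opNorm₂ (B * Bᴴ) < s) :
    ∃ (T : Matrix (Fin n) (Fin n ⊕ Fin n) ℂ) (d : Fin n ⊕ Fin n → ℝ),
      (∀ i, 0 < d i ∧ d i < s) ∧
      T * Matrix.diagonal (fun i => (d i : ℂ)) * Tᴴ = B * Bᴴ ∧
      T * Matrix.diagonal (fun i => (d i : ℂ)) * Tᵀ = B * M * Bᵀ ∧
      T * Tᴴ = (2 : ℂ) • 1 ∧ T * Tᵀ = 0 ∧
      (∀ x : Fin n ⊕ Fin n → ℝ, ∑ i, ‖(T *ᵥ fun k => (x k : ℂ)) i‖ ^ 2 = ∑ k, x k ^ 2) ∧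
      4 ^ n * ∏ i, d i = ‖B.det‖ ^ 4 * ∏ i, (1 - singularValue M i ^ 2) := by
  have hC : (B * Bᴴ)ᴴ = B * Bᴴ := by simp
  have hP : (B * M * Bᵀ)ᵀ = B * M * Bᵀ := by simp [Matrix.transpose_mul, hMt, Matrix.mul_assoc]
  have hdet := det_realCov (B := B) hMt
  have h1 := reIm_mul_realCov_mul_conjTranspose hC hP
  have h2 := reIm_mul_realCov_mul_transpose hC hP
  have hH := realCov_isHermitian hC hP
  have hq := realCov_quadForm_pos_lt hB hM hs
  set R := realCov (B * Bᴴ) (B * M * Bᵀ) with hR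
  set U : Matrix (Fin n ⊕ Fin n) (Fin n ⊕ Fin n) ℝ := ↑hH.eigenvectorUnitary with hU
  have hUU : U * Uᵀ = 1 := by
    have := Unitary.coe_mul_star_self hH.eigenvectorUnitary
    rwa [Unitary.coe_star, Matrix.star_eq_conjTranspose,
      Matrix.conjTranspose_eq_transpose_of_trivial] at this
  have hUU' : Uᵀ * U = 1 := by
    have := Unitary.coe_star_mul_self hH.eigenvectorUnitary
    rwa [Matrix.star_eq_conjTranspose,
      Matrix.conjTranspose_eq_transpose_of_trivial] at this
  have hspec : R = U * Matrix.diagonal hH.eigenvalues * Uᵀ := by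
    have := hH.spectral_theorem
    rw [Unitary.conjStarAlgAut_apply, Matrix.star_eq_conjTranspose,
      Matrix.conjTranspose_eq_transpose_of_trivial] at this
    exact this
  set V := U.map Complex.ofReal with hV
  have hVt : Vᵀ = Uᵀ.map Complex.ofReal := rfl
  have hVh : Vᴴ = Vᵀ := by
    ext i j
    simp [hV]
  have hVV : V * Vᵀ = 1 := by
    have := congrArg (fun A => A.map Complex.ofRealHom) hUU
    rw [Matrix.map_mul, Matrix.map_one _ (map_zero _) (map_one _)] at this
    exact this
  have hVspec : R.map Complex.ofReal
      = V * Matrix.diagonal (fun i => (hH.eigenvalues i : ℂ)) * Vᵀ := by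
    have := congrArg (fun A => A.map Complex.ofRealHom) hspec
    rw [Matrix.map_mul, Matrix.map_mul, Matrix.diagonal_map (map_zero _)] at this
    exact this
  refine ⟨reIm n * V, hH.eigenvalues, fun i => ?_, ?_, ?_, ?_, ?_, fun x => ?_, ?_⟩
  · set v : Fin n ⊕ Fin n → ℝ := ⇑(hH.eigenvectorBasis i) with hv
    have hv1 : ∑ k, v k ^ 2 = 1 := by
      have := hH.eigenvectorBasis.orthonormal.1 i
      rw [EuclideanSpace.norm_eq, Real.sqrt_eq_one] at this
      simpa using this
    have := hH.eigenvalues_eq i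
    simp only [star_trivial, RCLike.re_to_real] at this
    rw [this]
    exact hq v hv1
  · rw [Matrix.conjTranspose_mul, hVh, ← h1, hVspec]
    simp only [Matrix.mul_assoc]
  · rw [Matrix.transpose_mul, ← h2, hVspec]
    simp only [Matrix.mul_assoc]
  · rw [Matrix.conjTranspose_mul, hVh, Matrix.mul_assoc, ← Matrix.mul_assoc V, hVV, Matrix.one_mul,
      reIm_mul_conjTranspose]
  · rw [Matrix.transpose_mul, Matrix.mul_assoc, ← Matrix.mul_assoc V, hVV, Matrix.one_mul,
      reIm_mul_transpose]
  · have e : V *ᵥ (fun k => (x k : ℂ)) = fun k => ((U *ᵥ x) k : ℂ) := by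
      ext k
      simp [hV, Matrix.mulVec, dotProduct]
    rw [← Matrix.mulVec_mulVec, e, sum_norm_sq_reIm_mulVec]
    have e2 : (U *ᵥ x) ⬝ᵥ (U *ᵥ x) = x ⬝ᵥ x := by
      rw [Matrix.dotProduct_mulVec, ← Matrix.mulVec_transpose, Matrix.mulVec_mulVec, hUU',
        Matrix.one_mulVec]
    simpa [dotProduct, ← sq] using e2
  · rw [← hdet, hH.det_eq_prod_eigenvalues]
    rfl

end ComplexChannel

/-! ### Parallel real Gaussian channels -/

namespace ProbabilityTheory

open scoped NNReal

variable {ι : Type*} [Fintype ι]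

/-- After reduction to unit variances, Fubini and translation invariance show that a Lebesgue-null
set is null for the standard Gaussian translated by some x. That translate has a positive density
with respect to the centred one. -/
lemma pi_gaussianReal_absolutelyContinuous {d : ι → ℝ≥0} (hd : ∀ i, d i ≠ 0) :
    (Measure.pi fun i => gaussianReal 0 (d i)) ≪ (volume : Measure (ι → ℝ)) := by
  set π : Measure (ι → ℝ) := Measure.pi fun _ => gaussianReal 0 1 with hπ
  have h1 : (Measure.pi fun i => gaussianReal 0 (d i)) ≪ π := by
    rw [pi_gaussianReal_eq_withDensity hd one_ne_zero (fun _ => 0)]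
    exact withDensity_absolutelyContinuous _ _
  refine h1.trans (Measure.AbsolutelyContinuous.mk fun A hA hA0 => ?_)
  have hmeas : MeasurableSet {p : (ι → ℝ) × (ι → ℝ) | p.1 + p.2 ∈ A} :=
    (measurable_fst.add measurable_snd) hA
  have h2 : (volume.prod π) {p : (ι → ℝ) × (ι → ℝ) | p.1 + p.2 ∈ A} = 0 := by
    rw [Measure.prod_apply_symm hmeas]
    have (w : ι → ℝ) : (fun x : ι → ℝ => (x, w)) ⁻¹' {p | p.1 + p.2 ∈ A} = (· + w) ⁻¹' A := rfl
    simp [this, measure_preimage_add_right, hA0]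
  rw [Measure.measure_prod_null hmeas] at h2
  obtain ⟨x, hx⟩ := h2.exists
  have hx' : (π.map (x + ·)) A = 0 := by
    rw [Measure.map_apply (by fun_prop) hA]
    exact hx
  rw [hπ, pi_gaussianReal_map_add_left,
    pi_gaussianReal_eq_withDensity (fun _ => one_ne_zero) one_ne_zero x] at hx'
  have hm := measurable_gaussianLogRatio (fun _ : ι => (1 : ℝ≥0)) 1
  exact withDensity_absolutelyContinuous' (by fun_prop)
    (ae_of_all _ fun y => by simp [Real.exp_pos]) hx'

lemma memLp_eval_of_lintegral_sq_le {μ : Measure (ι → ℝ)} {S : ℝ}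
    (h : ∫⁻ x, ENNReal.ofReal (∑ i, x i ^ 2) ∂μ ≤ ENNReal.ofReal S) (i : ι) :
    MemLp (fun x => x i) 2 μ := by
  rw [memLp_two_iff_integrable_sq (measurable_pi_apply i).aestronglyMeasurable]
  refine ⟨((measurable_pi_apply i).pow_const 2).aestronglyMeasurable, ?_⟩
  rw [hasFiniteIntegral_iff_ofReal (ae_of_all _ fun x => sq_nonneg _)]
  refine lt_of_le_of_lt ?_ (h.trans_lt ENNReal.ofReal_lt_top)
  refine lintegral_mono fun x => ENNReal.ofReal_le_ofReal ?_
  exact Finset.single_le_sum (f := fun i => x i ^ 2) (fun i _ => sq_nonneg _) (Finset.mem_univ i)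

lemma sum_integral_sq_le {μ : Measure (ι → ℝ)} {S : ℝ} (hS : 0 ≤ S)
    (h : ∫⁻ x, ENNReal.ofReal (∑ i, x i ^ 2) ∂μ ≤ ENNReal.ofReal S) :
    ∑ i, ∫ x, x i ^ 2 ∂μ ≤ S := by
  have hLp := memLp_eval_of_lintegral_sq_le h
  rw [← integral_finsetSum _ fun i _ => (hLp i).integrable_sq,
    integral_eq_lintegral_of_nonneg_ae
      (ae_of_all _ fun x => Finset.sum_nonneg fun i _ => sq_nonneg _)
      (integrable_finsetSum _ fun i _ => (hLp i).integrable_sq).1]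
  exact ENNReal.toReal_le_of_le_ofReal hS h

/-- The joint law of `(x, x + w)`, where `x` has law `μ` and `w` is an independent Gaussian vector
with independent entries of variances `d i`. -/
noncomputable def gaussianChannelLaw (d : ι → ℝ≥0) (μ : Measure (ι → ℝ)) :
    Measure ((ι → ℝ) × (ι → ℝ)) :=
  (μ.prod (Measure.pi fun i => gaussianReal 0 (d i))).map fun p => (p.1, p.1 + p.2)

instance (d : ι → ℝ≥0) (μ : Measure (ι → ℝ)) [IsProbabilityMeasure μ] :
    IsProbabilityMeasure (gaussianChannelLaw d μ) :=
  Measure.isProbabilityMeasure_map (by fun_prop)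

lemma fst_gaussianChannelLaw (d : ι → ℝ≥0) (μ : Measure (ι → ℝ)) [IsProbabilityMeasure μ] :
    (gaussianChannelLaw d μ).fst = μ := by
  rw [gaussianChannelLaw, Measure.fst_map_prodMk (by fun_prop)]
  exact Measure.fst_prod

open InformationTheory

lemma klDiv_gaussianChannelLaw_le {d : ι → ℝ≥0} {s : ℝ≥0} (hd : ∀ i, d i ≠ 0) (hs : s ≠ 0)
    {S : ℝ} (hS : 0 ≤ S) (hsum : S + ∑ i, (d i : ℝ) = Fintype.card ι * s)
    (μ : Measure (ι → ℝ)) [IsProbabilityMeasure μ]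
    (hμ : ∫⁻ x, ENNReal.ofReal (∑ i, x i ^ 2) ∂μ ≤ ENNReal.ofReal S) :
    klDiv (gaussianChannelLaw d μ) ((gaussianChannelLaw d μ).fst.prod (gaussianChannelLaw d μ).snd)
      ≤ ENNReal.ofReal (1 / 2 * ∑ i, Real.log (s / d i)) := by
  refine (klDiv_prod_snd_le _ (Measure.pi fun _ => gaussianReal 0 s)).trans ?_
  rw [fst_gaussianChannelLaw, gaussianChannelLaw,
    klDiv_map_add_prod_gaussian μ hd hs (memLp_eval_of_lintegral_sq_le hμ)]
  refine ENNReal.ofReal_le_ofReal (add_le_of_nonpos_right ?_)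
  have := sum_integral_sq_le hS hμ
  exact div_nonpos_of_nonpos_of_nonneg (by linarith) (by positivity)

/-- The output law is exactly the reference law, so both losses in the upper bound vanish. -/
lemma klDiv_gaussianChannelLaw_pi {d e : ι → ℝ≥0} {s : ℝ≥0} (hd : ∀ i, d i ≠ 0) (hs : s ≠ 0)
    (he : ∀ i, e i + d i = s) :
    klDiv (gaussianChannelLaw d (Measure.pi fun i => gaussianReal 0 (e i)))
      ((gaussianChannelLaw d (Measure.pi fun i => gaussianReal 0 (e i))).fst.prod
        (gaussianChannelLaw d (Measure.pi fun i => gaussianReal 0 (e i))).snd)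
      = ENNReal.ofReal (1 / 2 * ∑ i, Real.log (s / d i)) := by
  classical
  have hsnd : (gaussianChannelLaw d (Measure.pi fun i => gaussianReal 0 (e i))).snd
      = Measure.pi fun _ => gaussianReal 0 s := by
    rw [gaussianChannelLaw, Measure.snd_map_prodMk (by fun_prop), map_add_prod_pi_gaussianReal]
    simp_rw [he]
  rw [hsnd, fst_gaussianChannelLaw, gaussianChannelLaw,
    klDiv_map_add_prod_gaussian _ hd hs (memLp_eval_pi_gaussianReal e)]
  have hsq (i : ι) : ∫ x, x i ^ 2 ∂(Measure.pi fun i => gaussianReal 0 (e i)) = e i := by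
    have := integral_eval_mul_eval_pi_gaussianReal e i i
    simpa [← sq] using this
  have hes (i : ι) : (e i : ℝ) + d i = s := by exact_mod_cast he i
  simp_rw [hsq]
  rw [← Finset.sum_add_distrib]
  simp [hes]

end ProbabilityTheory

/-! ### Transfer to the complex channel -/

namespace ComplexChannel

open scoped NNReal
open InformationTheory

variable {n : ℕ} {ι : Type*} [Fintype ι]

lemma exists_continuousLinearEquiv_realMulVec (T : Matrix (Fin n) ι ℂ)
    (hT : Function.Injective (realMulVec T)) (hι : Fintype.card ι = 2 * n) :
    ∃ e : (ι → ℝ) ≃L[ℝ] (Fin n → ℂ), ⇑e = realMulVec T := by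
  have hrank : Module.finrank ℝ (ι → ℝ) = Module.finrank ℝ (Fin n → ℂ) := by
    rw [Module.finrank_fintype_fun_eq_card, Module.finrank_pi_fintype]
    simp [hι, mul_comm]
  refine ⟨(LinearEquiv.ofBijective (realMulVec T : (ι → ℝ) →ₗ[ℝ] (Fin n → ℂ)) ⟨hT, ?_⟩
    ).toContinuousLinearEquiv, rfl⟩
  exact (LinearMap.injective_iff_surjective_of_finrank_eq_finrank hrank).1 hT

lemma realMulVec_mul (H : Matrix (Fin n) (Fin n) ℂ) (T : Matrix (Fin n) ι ℂ) (x : ι → ℝ) :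
    realMulVec (H * T) x = H *ᵥ realMulVec T x := by
  rw [realMulVec_apply, realMulVec_apply, Matrix.mulVec_mulVec]

/-- With input Tx and noise HTw, the output is HT(x + w): one coordinate change on each side yields
the diagonal channel. -/
lemma jointLaw_map_eq (H : Matrix (Fin n) (Fin n) ℂ) (T : Matrix (Fin n) ι ℂ) (d : ι → ℝ≥0)
    (μ : Measure (ι → ℝ)) [IsProbabilityMeasure μ] :
    jointLaw H ((Measure.pi fun i => gaussianReal 0 (d i)).map (realMulVec (H * T)))
        (μ.map (realMulVec T))
      = (gaussianChannelLaw d μ).map (Prod.map (realMulVec T) (realMulVec (H * T))) := by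
  have m1 : Measurable (realMulVec T) := (realMulVec T).continuous.measurable
  have m2 : Measurable (realMulVec (H * T)) := (realMulVec (H * T)).continuous.measurable
  have m3 : Measurable (fun p : (Fin n → ℂ) × (Fin n → ℂ) => (p.1, H *ᵥ p.1 + p.2)) := by
    refine Continuous.measurable ?_
    exact continuous_fst.prodMk ((Continuous.matrix_mulVec continuous_const continuous_fst).add
      continuous_snd)
  rw [jointLaw, gaussianChannelLaw, Measure.map_prod_map _ _ m1 m2,
    Measure.map_map m3 (m1.prodMap m2), Measure.map_map (m1.prodMap m2) (by fun_prop)]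
  congr 1
  ext p : 1
  simp [realMulVec_mul, map_add]

lemma sum_enorm_sq_eq {T : Matrix (Fin n) ι ℂ}
    (hT : ∀ x : ι → ℝ, ∑ i, ‖(T *ᵥ fun k => (x k : ℂ)) i‖ ^ 2 = ∑ k, x k ^ 2) (x : ι → ℝ) :
    ∑ i, ‖realMulVec T x i‖ₑ ^ 2 = ENNReal.ofReal (∑ k, x k ^ 2) := by
  rw [← hT, ENNReal.ofReal_sum_of_nonneg fun i _ => by positivity]
  refine Finset.sum_congr rfl fun i _ => ?_
  rw [ENNReal.ofReal_pow (norm_nonneg _), ofReal_norm]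
  rfl

/-- The capacity of a Gaussian channel in real coordinates which diagonalize the noise: `T` maps
`ℝ^ι` isometrically onto `ℂⁿ`, and `T` diagonalizes the covariance of `H⁻¹ z`. -/
lemma capacity_of_diagonalization {b : ℝ} {H : Matrix (Fin n) (Fin n) ℂ} (hH : H.det ≠ 0)
    {T : Matrix (Fin n) ι ℂ} (hι : Fintype.card ι = 2 * n)
    (hT : ∀ x : ι → ℝ, ∑ i, ‖(T *ᵥ fun k => (x k : ℂ)) i‖ ^ 2 = ∑ k, x k ^ 2)
    {d e : ι → ℝ≥0} {s : ℝ≥0} (hd : ∀ i, d i ≠ 0) (he : ∀ i, e i ≠ 0) (hs : s ≠ 0)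
    (hes : ∀ i, e i + d i = s) {S : ℝ} (hS : 0 ≤ S)
    (hsum : S + ∑ i, (d i : ℝ) = Fintype.card ι * s) {ν : Measure (Fin n → ℂ)}
    (hν : ν = (Measure.pi fun i => gaussianReal 0 (d i)).map (realMulVec (H * T))) :
    capacity b H ν (admissible n S)
        = ENNReal.ofReal (1 / 2 * ∑ i, Real.log (s / d i)) / ENNReal.ofReal (Real.log b) ∧
      IsCapacityAchieving b H ν (admissible n S)
        ((Measure.pi fun i => gaussianReal 0 (e i)).map (realMulVec T)) := by
  have inj1 : Function.Injective (realMulVec T) := by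
    refine (injective_iff_map_eq_zero (realMulVec T)).2 fun x hx => ?_
    have h := hT x
    rw [← realMulVec_apply, hx] at h
    simp only [Pi.zero_apply, norm_zero, ne_eq, OfNat.ofNat_ne_zero, not_false_eq_true, zero_pow,
      Finset.sum_const_zero] at h
    ext k
    have := (Finset.sum_eq_zero_iff_of_nonneg (fun k _ => sq_nonneg _)).1 h.symm k
      (Finset.mem_univ k)
    simpa using this
  have inj2 : Function.Injective (realMulVec (H * T)) := by
    intro x y hxy
    rw [realMulVec_mul, realMulVec_mul] at hxy
    refine inj1 (Matrix.mulVec_injective_of_isUnit ?_ hxy)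
    rwa [Matrix.isUnit_iff_isUnit_det, isUnit_iff_ne_zero]
  obtain ⟨L, hL⟩ := exists_continuousLinearEquiv_realMulVec T inj1 hι
  obtain ⟨L', hL'⟩ := exists_continuousLinearEquiv_realMulVec (H * T) inj2 hι
  have m1 : Measurable (realMulVec T) := (realMulVec T).continuous.measurable
  have hmi (μ : Measure (ι → ℝ)) [IsProbabilityMeasure μ] :
      mutualInfo b (jointLaw H ν (μ.map (realMulVec T))) = mutualInfo b (gaussianChannelLaw d μ) := by
    rw [hν, jointLaw_map_eq, ← hL, ← hL']
    exact mutualInfo_map_prodCongr b L.toHomeomorph.toMeasurableEquiv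
      L'.toHomeomorph.toMeasurableEquiv _
  have hpow (μ : Measure (ι → ℝ)) : ∫⁻ x, ∑ i, ‖x i‖ₑ ^ 2 ∂(μ.map (realMulVec T))
      = ∫⁻ x, ENNReal.ofReal (∑ k, x k ^ 2) ∂μ := by
    rw [lintegral_map (by fun_prop) m1]
    simp_rw [sum_enorm_sq_eq hT]
  have hle (μ) (hμ : μ ∈ admissible n S) : mutualInfo b (jointLaw H ν μ)
      ≤ ENNReal.ofReal (1 / 2 * ∑ i, Real.log (s / d i)) / ENNReal.ofReal (Real.log b) := by
    obtain ⟨h1, -, h3⟩ := hμ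
    -- `T` is bijective, so each input law comes from a law on `ι → ℝ`; being isometric, it
    -- preserves the power.
    have hmap : μ = (μ.map L.symm).map (realMulVec T) := by
      rw [← hL, Measure.map_map (by fun_prop) (by fun_prop)]
      simp
    have : IsProbabilityMeasure (μ.map L.symm) := Measure.isProbabilityMeasure_map (by fun_prop)
    rw [hmap, hpow] at h3
    rw [hmap, hmi, mutualInfo]
    gcongr
    exact klDiv_gaussianChannelLaw_le hd hs hS hsum _ h3
  set π := Measure.pi fun i => gaussianReal 0 (e i) with hπ
  have hval : mutualInfo b (jointLaw H ν (π.map (realMulVec T)))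
      = ENNReal.ofReal (1 / 2 * ∑ i, Real.log (s / d i)) / ENNReal.ofReal (Real.log b) := by
    rw [hmi, mutualInfo, hπ, klDiv_gaussianChannelLaw_pi hd hs hes]
  have hadm : π.map (realMulVec T) ∈ admissible n S := by
    refine ⟨Measure.isProbabilityMeasure_map m1.aemeasurable, ?_, ?_⟩
    -- A linear isomorphism carries Lebesgue measure to a Haar measure, equivalent to `volume` on
    -- ℂⁿ.
    · have h1 := (pi_gaussianReal_absolutelyContinuous he).map m1
      refine h1.trans ?_
      rw [← hL]
      have := L.isAddHaarMeasure_map (volume : Measure (ι → ℝ))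
      exact Measure.absolutelyContinuous_isAddHaarMeasure _ _
    · rw [hpow]
      have hLp := memLp_eval_pi_gaussianReal e
      rw [← ofReal_integral_eq_lintegral_ofReal
        (integrable_finsetSum _ fun i _ => (hLp i).integrable_sq)
        (ae_of_all _ fun x => Finset.sum_nonneg fun i _ => sq_nonneg _)]
      refine ENNReal.ofReal_le_ofReal (le_of_eq ?_)
      rw [integral_finsetSum _ fun i _ => (hLp i).integrable_sq]
      have hsq (i : ι) : ∫ x, x i ^ 2 ∂π = e i := by
        classical
        have := integral_eval_mul_eval_pi_gaussianReal e i i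
        simpa [← sq] using this
      have hes' : ∑ i, ((e i : ℝ) + d i) = ∑ _i : ι, (s : ℝ) :=
        Finset.sum_congr rfl fun i _ => by exact_mod_cast hes i
      rw [Finset.sum_add_distrib, Finset.sum_const, nsmul_eq_mul, Finset.card_univ] at hes'
      rw [Finset.sum_congr rfl fun i _ => hsq i]
      linarith
  have hcap : capacity b H ν (admissible n S)
      = ENNReal.ofReal (1 / 2 * ∑ i, Real.log (s / d i)) / ENNReal.ofReal (Real.log b) := by
    refine le_antisymm (iSup₂_le hle) ?_
    rw [← hval]
    exact le_iSup₂ (f := fun μ (_ : μ ∈ admissible n S) => mutualInfo b (jointLaw H ν μ)) _ hadm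
  exact ⟨hcap, hadm, hval.trans hcap.symm⟩

end ComplexChannel

/-! ### The closed formula and assembly -/

namespace ComplexChannel
variable {n : ℕ}

open scoped ComplexOrder in
lemma trace_mul_conjTranspose_pos (hn : 0 < n) {B : Matrix (Fin n) (Fin n) ℂ} (hB : B.det ≠ 0) :
    0 < (B * Bᴴ).trace.re ∧ (B * Bᴴ).trace = ((B * Bᴴ).trace.re : ℂ) := by
  have h0 := (Matrix.posSemidef_self_mul_conjTranspose B).trace_nonneg
  have hne : (B * Bᴴ).trace ≠ 0 := by
    rw [Ne, Matrix.trace_mul_conjTranspose_self_eq_zero_iff]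
    rintro rfl
    have : Nonempty (Fin n) := ⟨⟨0, hn⟩⟩
    simp [Matrix.det_zero] at hB
  have hlt := lt_of_le_of_ne h0 hne.symm
  rw [Complex.lt_def] at hlt
  exact ⟨hlt.1, Complex.ext rfl hlt.2.symm⟩

lemma capacity_value {b : ℝ} (hn : 0 < n) {h β A : ℝ} (hh : 0 < h) (hβ : 0 < β)
    (hA : 0 < A) {d : Fin n ⊕ Fin n → ℝ} (hd : ∀ i, 0 < d i) {σ : Fin n → ℝ}
    (hprod : 4 ^ n * ∏ i, d i = (β / h) ^ 4 * ∏ i, (1 - σ i ^ 2)) :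
    1 / 2 * ∑ i, Real.log (A / n / 2 / d i) / Real.log b =
      2 * Real.logb b h + n * Real.logb b A - Real.logb b (β ^ 2)
        - 1 / 2 * ∑ i, Real.logb b (1 - σ i ^ 2) - n * Real.logb b n := by
  have hn' : (0 : ℝ) < n := by exact_mod_cast hn
  have hdp : 0 < ∏ i, d i := Finset.prod_pos fun i _ => hd i
  -- Positivity of the `d i` already rules out zero factors, as the logarithm of the product
  -- requires.
  have hne : ∏ i, (1 - σ i ^ 2) ≠ 0 := by
    intro h0
    rw [h0, mul_zero] at hprod
    have : 0 < 4 ^ n * ∏ i, d i := by positivity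
    linarith
  have hlog := congrArg Real.log hprod
  rw [Real.log_mul (by positivity) hdp.ne', Real.log_pow, Real.log_mul (by positivity) hne,
    Real.log_pow, Real.log_div hβ.ne' hh.ne', Real.log_prod (fun i _ => (hd i).ne'),
    Real.log_prod (fun i _ => Finset.prod_ne_zero_iff.1 hne i (Finset.mem_univ i)),
    show (4 : ℝ) = 2 ^ 2 by norm_num, Real.log_pow] at hlog
  have e1 (i) : Real.log (A / n / 2 / d i)
      = Real.log A - Real.log n - Real.log 2 - Real.log (d i) := by
    rw [Real.log_div (by positivity) (hd i).ne', Real.log_div (by positivity) (by positivity),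
      Real.log_div hA.ne' hn'.ne']
  simp only [Real.logb, ← Finset.sum_div]
  simp_rw [e1]
  rw [Finset.sum_sub_distrib, Real.log_pow]
  simp only [Finset.sum_const, Finset.card_univ, Fintype.card_sum, Fintype.card_fin, nsmul_eq_mul]
  push_cast at hlog ⊢
  have e2 : ∑ i, Real.log (d i) = 4 * (Real.log β - Real.log h) + ∑ i, Real.log (1 - σ i ^ 2)
      - n * (2 * Real.log 2) := by linarith
  rw [e2]
  ring

end ComplexChannel

theorem mainTheorem10 (b : ℝ) (hb : 1 < b) (n : ℕ) (hn : 0 < n)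
    (H : Matrix (Fin n) (Fin n) ℂ) (hH : H.det ≠ 0)
    (ν : Measure (Fin n → ℂ)) (Cz Pz : Matrix (Fin n) (Fin n) ℂ)
    (hν : IsZeroMeanGaussian ν Cz Pz) (hCz : Cz.det ≠ 0)
    (Bz : Matrix (Fin n) (Fin n) ℂ) (hBz : Cz = Bz * Bzᴴ)
    (hPz : opNorm₂ (Bz⁻¹ * Pz * (Bz⁻¹)ᵀ) < 1)
    (S : ℝ) (hS : 2 * (n : ℝ) * opNorm₂ (H⁻¹ * Cz * (H⁻¹)ᴴ) ≤ S) :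
    (capacity b H ν (admissible n S) : EReal) =
        ((2 * Real.logb b ‖H.det‖
          + n * Real.logb b (S + (H⁻¹ * Cz * (H⁻¹)ᴴ).trace.re)
          - Real.logb b Cz.det.re
          - 1 / 2 * ∑ i, Real.logb b (1 - singularValue (Bz⁻¹ * Pz * (Bz⁻¹)ᵀ) i ^ 2)
          - n * Real.logb b n : ℝ) : EReal) ∧
      (∃ μ : Measure (Fin n → ℂ), IsZeroMeanGaussian μ
        ((((S : ℂ) + (H⁻¹ * Cz * (H⁻¹)ᴴ).trace) / n) • (1 : Matrix (Fin n) (Fin n) ℂ)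
          - H⁻¹ * Cz * (H⁻¹)ᴴ)
        (-(H⁻¹ * Pz * (H⁻¹)ᵀ))) ∧
      ∀ μ : Measure (Fin n → ℂ), IsZeroMeanGaussian μ
        ((((S : ℂ) + (H⁻¹ * Cz * (H⁻¹)ᴴ).trace) / n) • (1 : Matrix (Fin n) (Fin n) ℂ)
          - H⁻¹ * Cz * (H⁻¹)ᴴ)
        (-(H⁻¹ * Pz * (H⁻¹)ᵀ)) →
        IsCapacityAchieving b H ν (admissible n S) μ := by
  have hn' : (0 : ℝ) < n := by exact_mod_cast hn
  have hBdet : Bz.det ≠ 0 := by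
    rintro h0
    simp [hBz, h0] at hCz
  have hHu : IsUnit H.det := isUnit_iff_ne_zero.2 hH
  have hBu : IsUnit Bz.det := isUnit_iff_ne_zero.2 hBdet
  set M := Bz⁻¹ * Pz * (Bz⁻¹)ᵀ with hM
  have hMt : Mᵀ = M := by
    simp [hM, Matrix.transpose_mul, hν.transpose_compCov, Matrix.mul_assoc]
  have hPzM : Pz = Bz * M * Bzᵀ := by
    have e : (Bz⁻¹)ᵀ * Bzᵀ = 1 := by
      rw [← Matrix.transpose_mul, Matrix.mul_nonsing_inv _ hBu, Matrix.transpose_one]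
    rw [hM, Matrix.mul_assoc, Matrix.mul_assoc, e, Matrix.mul_one, ← Matrix.mul_assoc,
      Matrix.mul_nonsing_inv _ hBu, Matrix.one_mul]
  set B := H⁻¹ * Bz with hB
  have hC : H⁻¹ * Cz * (H⁻¹)ᴴ = B * Bᴴ := by
    rw [hBz, hB, Matrix.conjTranspose_mul]
    simp only [Matrix.mul_assoc]
  have hP : H⁻¹ * Pz * (H⁻¹)ᵀ = B * M * Bᵀ := by
    rw [hPzM, hB, Matrix.transpose_mul]
    simp only [Matrix.mul_assoc]
  have hBdet' : B.det = Bz.det / H.det := by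
    rw [hB, Matrix.det_mul, Matrix.det_nonsing_inv, Ring.inverse_eq_inv']
    field_simp
  have hBne : B.det ≠ 0 := by
    rw [hBdet']
    exact div_ne_zero hBdet hH
  have hHB : H * B = Bz := by
    rw [hB, ← Matrix.mul_assoc, Matrix.mul_nonsing_inv _ hHu, Matrix.one_mul]
  rw [hC, hP]
  rw [hC] at hS
  obtain ⟨htr, htr'⟩ := trace_mul_conjTranspose_pos hn hBne
  set τ := (B * Bᴴ).trace.re with hτ
  have hop : 0 ≤ opNorm₂ (B * Bᴴ) := norm_nonneg _
  have hS0 : 0 ≤ S := le_trans (by positivity) hS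
  -- The common output variance per real coordinate: total output power, pulled back by H⁻¹, over
  -- 2n.
  obtain ⟨s, hs⟩ : ∃ s : ℝ, s = (S + τ) / n / 2 := ⟨_, rfl⟩
  have hs0 : 0 < s := by rw [hs]; positivity
  -- The power hypothesis gives S/(2n) ≥ ‖BBᴴ‖; the positive trace makes the inequality strict, so
  -- every input variance is positive.
  have hlt : opNorm₂ (B * Bᴴ) < s := by
    rw [hs, lt_div_iff₀ two_pos, lt_div_iff₀ hn']
    linarith
  obtain ⟨T, d, hd, hT1, hT2, hT3, hT4, hT5, hT6⟩ := exists_real_diagonalization hBne hMt hPz hlt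
  have hsumd : ∑ k, d k = τ := by
    have h1 : (B * Bᴴ).trace = ∑ k, (d k : ℂ) * (Tᴴ * T) k k := by
      rw [← hT1, Matrix.mul_assoc, Matrix.trace_mul_comm, Matrix.mul_assoc, Matrix.trace]
      simp [Matrix.diagonal_mul]
    -- Only the diagonal of TᴴT is known: `T` preserves norms of real vectors, so its columns are
    -- unit vectors.
    have h2 (k) : (Tᴴ * T) k k = 1 := by
      have h3 := hT5 (Pi.single k 1)
      have h4 : (fun l => ((Pi.single k 1 : Fin n ⊕ Fin n → ℝ) l : ℂ)) = Pi.single k 1 := by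
        ext l
        by_cases hl : l = k <;> simp [hl]
      rw [h4, Matrix.mulVec_single_one] at h3
      simp only [Pi.single_apply, ite_pow, one_pow, zero_pow two_ne_zero, Finset.sum_ite_eq',
        Finset.mem_univ, if_true] at h3
      rw [Matrix.mul_apply, ← Complex.ofReal_one, ← h3]
      simp [Complex.conj_mul']
    simp_rw [h2, mul_one] at h1
    rw [htr'] at h1
    exact_mod_cast h1.symm
  lift d to (Fin n ⊕ Fin n) → NNReal using fun i => (hd i).1.le
  lift s to NNReal using hs0.le
  have hds (i) : d i ≤ s := by exact_mod_cast (hd i).2.le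
  have hes (i) : (s - d i) + d i = s := tsub_add_cancel_of_le (hds i)
  have hd0 (i) : d i ≠ 0 := fun h => by simpa [h] using (hd i).1
  have he0 (i) : s - d i ≠ 0 := by
    have : d i < s := by exact_mod_cast (hd i).2
    exact (tsub_pos_of_lt this).ne'
  have hs_ne : s ≠ 0 := fun h => by simp [h] at hs0
  have hνeq : ν = (Measure.pi fun i => gaussianReal 0 (d i)).map (realMulVec (H * T)) := by
    refine hν.ext ?_
    have h := isZeroMeanGaussian_map_realMulVec (H * T) d
    have e1 : H * T * Matrix.diagonal (fun i => ((d i : ℝ) : ℂ)) * (H * T)ᴴ = Cz := by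
      rw [Matrix.conjTranspose_mul, hBz, ← hHB, Matrix.conjTranspose_mul]
      calc _ = H * (T * Matrix.diagonal (fun i => ((d i : ℝ) : ℂ)) * Tᴴ) * Hᴴ := by
            simp only [Matrix.mul_assoc]
        _ = _ := by rw [hT1]; simp only [Matrix.mul_assoc]
    have e2 : H * T * Matrix.diagonal (fun i => ((d i : ℝ) : ℂ)) * (H * T)ᵀ = Pz := by
      rw [Matrix.transpose_mul, hPzM, ← hHB, Matrix.transpose_mul]
      calc _ = H * (T * Matrix.diagonal (fun i => ((d i : ℝ) : ℂ)) * Tᵀ) * Hᵀ := by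
            simp only [Matrix.mul_assoc]
        _ = _ := by rw [hT2]; simp only [Matrix.mul_assoc]
    rwa [e1, e2] at h
  have hsum : S + ∑ i, (d i : ℝ) = Fintype.card (Fin n ⊕ Fin n) * (s : ℝ) := by
    rw [hsumd, hs]
    simp only [Fintype.card_sum, Fintype.card_fin]
    push_cast
    field_simp
    ring
  obtain ⟨hcap, hach⟩ := capacity_of_diagonalization (b := b) hH (by simp [two_mul]) hT5 hd0 he0
    hs_ne hes hS0 hsum hνeq
  have hμ := isZeroMeanGaussian_map_realMulVec T (fun i => s - d i)
  have hdiag : Matrix.diagonal (fun i => (((s - d i : NNReal) : ℝ) : ℂ))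
      = ((s : ℝ) : ℂ) • 1 - Matrix.diagonal (fun i => ((d i : ℝ) : ℂ)) := by
    ext i j
    rw [Matrix.sub_apply, Matrix.smul_apply, Matrix.diagonal_apply, Matrix.diagonal_apply,
      Matrix.one_apply]
    split_ifs
    · rw [NNReal.coe_sub (hds i)]
      simp
    · simp
  -- The factor 2 is that of TTᴴ = 2: each complex coordinate has two real ones.
  have hscal : ((S : ℂ) + (B * Bᴴ).trace) / n = ((s : ℝ) : ℂ) * 2 := by
    rw [htr', hs]
    push_cast
    ring
  have e1 : T * Matrix.diagonal (fun i => (((s - d i : NNReal) : ℝ) : ℂ)) * Tᴴ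
      = (((S : ℂ) + (B * Bᴴ).trace) / n) • 1 - B * Bᴴ := by
    rw [hdiag, Matrix.mul_sub, Matrix.sub_mul, hT1, Matrix.mul_smul, Matrix.mul_one,
      Matrix.smul_mul, hT3, smul_smul, hscal]
  have e2 : T * Matrix.diagonal (fun i => (((s - d i : NNReal) : ℝ) : ℂ)) * Tᵀ
      = -(B * M * Bᵀ) := by
    rw [hdiag, Matrix.mul_sub, Matrix.sub_mul, hT2, Matrix.mul_smul, Matrix.mul_one,
      Matrix.smul_mul, hT4, smul_zero, zero_sub]
  rw [e1, e2] at hμ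
  refine ⟨?_, ⟨_, hμ⟩, fun μ' hμ' => hμ'.ext hμ ▸ hach⟩
  have hlogb : 0 < Real.log b := Real.log_pos hb
  -- Ensures that `ENNReal.ofReal` does not truncate the value.
  have hpos : 0 ≤ 1 / 2 * ∑ i, Real.log (s / d i) := by
    refine mul_nonneg (by norm_num) (Finset.sum_nonneg fun i _ => Real.log_nonneg ?_)
    rw [one_le_div (hd i).1]
    exact (hd i).2.le
  rw [hcap, ← ENNReal.ofReal_div_of_pos hlogb, EReal.coe_ennreal_ofReal,
    max_eq_left (by positivity)]
  congr 1
  have hdet : Cz.det.re = ‖Bz.det‖ ^ 2 := by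
    rw [hBz, Matrix.det_mul, Matrix.det_conjTranspose, RCLike.star_def, Complex.mul_conj']
    norm_cast
  rw [hBdet', norm_div] at hT6
  rw [hdet, ← capacity_value (b := b) hn (norm_pos_iff.2 hH) (norm_pos_iff.2 hBdet)
    (add_pos_of_nonneg_of_pos hS0 htr) (fun i => (hd i).1) hT6, ← hs, ← Finset.sum_div]
  ring
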